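/- \textbf{Setting.} Let $c,\lambda,\mu,q>0$, $k\ge 1$ and $P\in\mathbb R$. Claims arrive at the epochs $S_1<S_2<\cdots$ of a Poisson process of intensity $\lambda$ and have i.i.d. sizes that are exponential of rate $\mu$ and independent of the arrivals; premiums come in at rate $c$. Under the $(-a,0,b)$ policy ($a,b\ge 0$) the reserve starts at $0$; everything above the barrier $b$ is paid out as dividends (cumulative amount $D_t$); if a claim makes the reserve negative with deficit at most $a$, the deficit is injected and the reserve restarts from $0$ (cumulative injections $C_t$); at the first time $T$ at which the deficit exceeds $a$, bankruptcy is declared. Put $$J_0^{a,b}=\mathbb E\Big[\int_{[0,T]}e^{-qt}(dD_t-k\,dC_t)-Pe^{-qT}\Big].$$ Let $W_q$ be the $q$-scale function, i.e. the continuous nonnegative function on $[0,\infty)$ with Laplace transform $1/(\kappa(s)-q)$ for large $s$, where $\kappa(s)=cs-\int_0^\infty(1-e^{-sy})\lambda\mu e^{-\mu y}dy$. Let $F(a)=1-e^{-\mu a}$, $\bar F=1-F$, $m(a)=\int_0^a z\mu e^{-\mu z}dz$, $C(x)=\int_0^xW_q(x-y)\lambda\bar F(y)\,dy$, $$\gamma=\frac1{C'},\qquad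 \theta=\frac{W_q}{C'},\qquad j=\frac{\gamma'}{q\theta'},\qquad s(b)=\frac{j(b)+P}{k}$$ (derivatives in $b$ on $[0,\infty)$ are one-sided at $b=0$), and, for $b\ge0$ and real $a$, $$\eta(b,a)=\frac{\gamma(b)}{\theta(b)}-\frac{k}{\mu\theta(b)}F(a)-q(ka-P),\qquad \eta(b)=\eta(b,s(b)),\qquad h(b)=\frac1{q\theta(b)}-\frac{\mu}{k}\Big(\frac{\gamma(b)}{q\theta(b)}+P\Big).$$ Let $L_0:[-e^{-1},\infty)\to[-1,\infty)$ be the principal branch of the Lambert function, the inverse of $z\mapsto ze^z$ on $[-1,\infty)$. \textbf{Proposition (cost function and optimality equations for exponential claims).} 1. For $a,b\ge0$ the discounted profit is integrable, $C'(b)>0$, and $$J_0^{a,b}=\frac{1-C'(b)\,(k\,m(a)+P\bar F(a))}{\bar F(a)C'(b)+qW_q(b)}=\frac{\gamma(b)-k\,m(a)-P\bar F(a)}{q\theta(b)+\bar F(a)}.$$ 2. For $a,b\ge 0$, $\gamma$ and $\theta$ are differentiable at $b$, $\theta'(b)>0$, and $\partial_bJ_0^{a,b}=0$ if and only if $J_0^{a,b}=j(b)$.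 3. For $a>0$, $b\ge0$, $\partial_aJ_0^{a,b}=0$ if and only if $J_0^{a,b}=ka-P$, if and only if $\eta(b,a)=0$. 4. Let $P\ge -c/q$ and $b\ge0$. The equation $\eta(b,a)=0$ has exactly one real solution, $$a(b)=\frac1\mu\Big(-h(b)+L_0\Big(\frac{e^{h(b)}}{q\theta(b)}\Big)\Big).$$ It is positive if and only if $P>-1/(qW_q(b))$; in particular it is positive if $P\ge 0$. If $a(b)\ge0$, then $a(b)$ maximizes $a\mapsto J_0^{a,b}$ over $a\ge0$, and $$J_0^{a(b),b}=\frac k\mu\Big(-h(b)+L_0\Big(\frac{e^{h(b)}}{q\theta(b)}\Big)\Big)-P.$$ 5. Let $b=0$ and $\tilde c=c+qP$. Then $\eta(0,a)=\tilde c-k\big(aq+\frac\lambda\mu(1-e^{-\mu a})\big)$ for all real $a$. With $g=h(0)=\frac\lambda q-\frac{\mu}{kq}\tilde c$: if $P\ge-c/q$, the only real zero of $\eta(0,\cdot)$ is given by $\mu a=-g+L_0\big(\frac\lambda qe^{g}\big)$; the right-hand side is positive if $\tilde c>0$. 6. For all $b\ge 0$, $\eta(b)=\frac{\gamma(b)}{\theta(b)}-q\,j(b)-\frac{k}{\mu\theta(b)}F\big(\frac{j(b)+P}{k}\big)$.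 If $a^*>0$, $b^*>0$ and both partial derivatives of $J_0^{a,b}$ vanish at $(a^*,b^*)$, then $J_0^{a^*,b^*}=j(b^*)=ka^*-P$, so $a^*=s(b^*)=(j(b^*)+P)/k$, and $\eta(b^*)=0$. 7. For $b\ge0$, $\eta(b)=0$ if and only if $1+\frac{q\theta(b)j(b)-\gamma(b)}{k/\mu}>0$ and $$P=-\frac k\mu\log\Big[1+\frac{q\theta(b)j(b)-\gamma(b)}{k/\mu}\Big]-j(b).$$ -/

import Mathlib

open MeasureTheory ProbabilityTheory Set Filter Topology

noncomputable section

namespace CramerLundberg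

/-! ### The reserve under a bounded buffer policy

`τ n` is the waiting time between the `n`-th and the `(n+1)`-st claim, `y n` is the size of the
`(n+1)`-st claim. The definitions of this section are pathwise: they take one realization
`τ y : ℕ → ℝ`. The initial reserve `x` is meant to satisfy `0 ≤ x ≤ b`. -/

/-- The epoch of the `n`-th claim; `claimTime τ 0 = 0` is the start. -/
def claimTime (τ : ℕ → ℝ) (n : ℕ) : ℝ := ∑ i ∈ Finset.range n, τ i

/-- The claim counting process `N_t`: the number of claims in `[0, t]`. -/
def claimCount (τ : ℕ → ℝ) (t : ℝ) : ℕ := Set.ncard {n : ℕ | claimTime τ (n + 1) ≤ t}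

/-- The reserve just after the `n`-th claim and after a possible capital injection. Between claims
the reserve grows at the premium rate `c` and everything above the barrier `b` is paid out;
if a claim makes it negative, it is brought back to `0`. -/
def reserveAfterClaim (c b x : ℝ) (τ y : ℕ → ℝ) : ℕ → ℝ
  | 0 => x
  | n + 1 => max 0 (min b (reserveAfterClaim c b x τ y n + c * τ n) - y n)

/-- The overshoot below `0` caused by the `(n+1)`-st claim (negative if the reserve stays
positive). -/
def deficit (c b x : ℝ) (τ y : ℕ → ℝ) (n : ℕ) : ℝ :=
  y n - min b (reserveAfterClaim c b x τ y n + c * τ n)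

/-- Bankruptcy: the first claim epoch at which the overshoot below `0` exceeds `a`
(`⊤` if there is none). -/
def bankruptcyTime (c a b x : ℝ) (τ y : ℕ → ℝ) : ENNReal :=
  ⨅ (n : ℕ) (_ : a < deficit c b x τ y n), ENNReal.ofReal (claimTime τ (n + 1))

/-- The controlled reserve at time `t` (before bankruptcy). -/
def reserve (c b x : ℝ) (τ y : ℕ → ℝ) (t : ℝ) : ℝ :=
  min b (reserveAfterClaim c b x τ y (claimCount τ t) + c * (t - claimTime τ (claimCount τ t)))

/-- The random measure `dD_t` of the cumulative dividends: before bankruptcy, the premium rate `c`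
is paid out while the reserve is at the barrier `b`. -/
def dividendMeasure (c a b x : ℝ) (τ y : ℕ → ℝ) : Measure ℝ :=
  ENNReal.ofReal c • (volume : Measure ℝ).restrict
    {t | 0 ≤ t ∧ ENNReal.ofReal t < bankruptcyTime c a b x τ y ∧ reserve c b x τ y t = b}

/-- The random measure `dC_t` of the cumulative capital injections: at each claim epoch before
bankruptcy the deficit, if there is one, is injected. -/
def injectionMeasure (c a b x : ℝ) (τ y : ℕ → ℝ) : Measure ℝ :=
  Measure.sum fun n : ℕ =>
    (if ENNReal.ofReal (claimTime τ (n + 1)) < bankruptcyTime c a b x τ y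
      then ENNReal.ofReal (deficit c b x τ y n) else 0) • Measure.dirac (claimTime τ (n + 1))

/-- The discount factor `exp (-q T)`, with `exp (-q ∞) = 0`. -/
def discount (q : ℝ) (T : ENNReal) : ℝ := if T = ⊤ then 0 else Real.exp (-(q * T.toReal))

/-- The discounted profit `∫_[0,T] e^{-qt} (dD_t - k dC_t) - P e^{-qT}` of the `(-a, 0, b)` policy
along one realization. -/
def profit (c q k P a b x : ℝ) (τ y : ℕ → ℝ) : ℝ :=
  (∫ t, Real.exp (-(q * t)) ∂(dividendMeasure c a b x τ y))
    - k * (∫ t, Real.exp (-(q * t)) ∂(injectionMeasure c a b x τ y))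
    - P * discount q (bankruptcyTime c a b x τ y)

/-- Claims arrive according to a Poisson process of intensity `lam` (the waiting times are i.i.d.
exponential of rate `lam`); the claim sizes are i.i.d. exponential of rate `mu`, independent of the
claim epochs. -/
structure IsExponentialClaims {Ω : Type*} [MeasurableSpace Ω] (Pr : Measure Ω) (lam mu : ℝ)
    (τ Y : ℕ → Ω → ℝ) : Prop where
  law_waiting : ∀ n, HasLaw (τ n) (expMeasure lam) Pr
  law_claim : ∀ n, HasLaw (Y n) (expMeasure mu) Pr
  indep : iIndepFun (fun i : ℕ ⊕ ℕ => Sum.elim τ Y i) Pr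

/-- The expected discounted profit `J_x^{a,b}` of the `(-a, 0, b)` policy, for `0 ≤ x ≤ b`. -/
def expectedProfit {Ω : Type*} [MeasurableSpace Ω] (Pr : Measure Ω) (τ Y : ℕ → Ω → ℝ)
    (c q k P a b x : ℝ) : ℝ :=
  ∫ ω, profit c q k P a b x (fun n => τ n ω) (fun n => Y n ω) ∂Pr

/-! ### The scale function and the functions derived from it -/

/-- The Laplace exponent `κ(s) = c s - ∫_0^∞ (1 - e^{-sy}) ν(y) dy` of the risk process with
Lévy density `ν(y) = lam * mu * e^{-mu y}`. -/
def laplaceExponent (c lam mu s : ℝ) : ℝ :=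
  c * s - ∫ y in Ioi (0 : ℝ), (1 - Real.exp (-(s * y))) * (lam * (mu * Real.exp (-(mu * y))))

/-- `W` is the `q`-scale function: it vanishes on the negative half-line, is nonnegative, is
continuous on `[0, ∞)`, and its Laplace transform is `1 / (κ(s) - q)` for all large `s`. -/
structure IsScaleFunction (c lam mu q : ℝ) (W : ℝ → ℝ) : Prop where
  zero_of_neg : ∀ x < 0, W x = 0
  nonneg : ∀ x, 0 ≤ W x
  continuousOn : ContinuousOn W (Ici 0)
  laplace : ∀ᶠ s in atTop, laplaceExponent c lam mu s ≠ q ∧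
    IntegrableOn (fun x => Real.exp (-(s * x)) * W x) (Ioi 0) ∧
    ∫ x in Ioi (0 : ℝ), Real.exp (-(s * x)) * W x = 1 / (laplaceExponent c lam mu s - q)

lemma laplaceExponent_eq {c lam mu s : ℝ} (hmu : 0 < mu) (hs : 0 < s) :
    laplaceExponent c lam mu s = c * s - lam * s / (mu + s) := by
  have h1 := integral_exp_mul_Ioi (a := -mu) (by linarith) 0
  have h2 := integral_exp_mul_Ioi (a := -(mu + s)) (by linarith) 0
  have i1 := integrableOn_exp_mul_Ioi (a := -mu) (by linarith) 0
  have i2 := integrableOn_exp_mul_Ioi (a := -(mu + s)) (by linarith) 0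
  have e : (fun y : ℝ => (1 - Real.exp (-(s * y))) * (lam * (mu * Real.exp (-(mu * y)))))
      = fun y : ℝ => lam * mu * (Real.exp (-mu * y) - Real.exp (-(mu + s) * y)) := by
    funext y
    have : Real.exp (-(mu + s) * y) = Real.exp (-(s * y)) * Real.exp (-(mu * y)) := by
      rw [← Real.exp_add]; congr 1; ring
    rw [this, neg_mul]; ring
  rw [laplaceExponent, e, integral_const_mul, integral_sub i1 i2, h1, h2]
  have : mu + s ≠ 0 := by linarith
  simp only [mul_zero, Real.exp_zero]
  field_simp
  ring

/-- The scale function exists. -/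
theorem exists_isScaleFunction {c lam mu q : ℝ} (hc : 0 < c) (hlam : 0 < lam) (hmu : 0 < mu)
    (hq : 0 < q) : ∃ W, IsScaleFunction c lam mu q W := by
  set B := c * mu - lam - q with hB
  set D := Real.sqrt (B ^ 2 + 4 * c * (q * mu)) with hD
  have hpos : 0 < 4 * c * (q * mu) := by positivity
  have hD2 : D ^ 2 = B ^ 2 + 4 * c * (q * mu) := Real.sq_sqrt (by positivity)
  have hD0 : 0 ≤ D := Real.sqrt_nonneg _
  have hDp : 0 < D := by
    rcases hD0.lt_or_eq with h | h
    · exact h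
    · rw [← h] at hD2; nlinarith [sq_nonneg B]
  set F := (-B + D) / (2 * c) with hF
  set r := (-B - D) / (2 * c) with hr
  have hsub : c * (F - r) = D := by rw [hF, hr]; field_simp; ring
  have hsum : c * (F + r) = -B := by rw [hF, hr]; field_simp; ring
  have hprod : c * (F * r) = -(q * mu) := by
    rw [hF, hr]; field_simp; nlinarith
  have hFr : r < F := by
    have : 0 < F - r := by
      by_contra h; nlinarith
    linarith
  have hmr : 0 < mu + r := by
    have h1 : c * ((mu + F) * (mu + r)) = lam * mu := by
      have : c * ((mu + F) * (mu + r)) = c * mu ^ 2 + mu * (c * (F + r)) + c * (F * r) := by ring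
      rw [this, hsum, hprod, hB]; ring
    have h2 : 0 < (mu + F) * (mu + r) := by
      by_contra h; nlinarith [mul_pos hlam hmu]
    by_contra h
    have hF0 : 0 < F := by
      by_contra hF'
      have : 0 ≤ F * r := by nlinarith
      nlinarith [mul_pos hq hmu]
    nlinarith
  have hFp : 0 < mu + F := by linarith
  have hgap : 0 < c * (F - r) := by rw [hsub]; exact hDp
  refine ⟨fun x => if x < 0 then 0 else
    ((mu + F) * Real.exp (F * x) - (mu + r) * Real.exp (r * x)) / (c * (F - r)), ?_, ?_, ?_, ?_⟩
  · intro x hx; simp [hx]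
  · intro x
    split_ifs with h
    · exact le_rfl
    · have hx : 0 ≤ x := not_lt.mp h
      apply div_nonneg _ hgap.le
      have : Real.exp (r * x) ≤ Real.exp (F * x) := Real.exp_le_exp.2 (by nlinarith)
      nlinarith [Real.exp_pos (r * x)]
  · have : ContinuousOn (fun x : ℝ => ((mu + F) * Real.exp (F * x) - (mu + r) * Real.exp (r * x))
      / (c * (F - r))) (Ici 0) := by fun_prop
    refine this.congr fun x hx => ?_
    have : ¬ x < 0 := not_lt.mpr hx
    simp [this]
  · filter_upwards [eventually_gt_atTop 0, eventually_gt_atTop F] with s hs hsF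
    have hsr : r < s := hFr.trans hsF
    have hms : mu + s ≠ 0 := by linarith
    have hk : laplaceExponent c lam mu s - q = c * ((s - F) * (s - r)) / (mu + s) := by
      rw [laplaceExponent_eq hmu hs]
      have : c * ((s - F) * (s - r)) = c * s ^ 2 - s * (c * (F + r)) + c * (F * r) := by ring
      rw [this, hsum, hprod, hB]
      field_simp
      ring
    have h1 : s - F ≠ 0 := by linarith
    have h2 : s - r ≠ 0 := by linarith
    have i1 := integrableOn_exp_mul_Ioi (a := F - s) (by linarith) 0
    have i2 := integrableOn_exp_mul_Ioi (a := r - s) (by linarith) 0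
    have v1 := integral_exp_mul_Ioi (a := F - s) (by linarith) 0
    have v2 := integral_exp_mul_Ioi (a := r - s) (by linarith) 0
    have e : EqOn (fun x => Real.exp (-(s * x)) * (if x < 0 then 0 else
        ((mu + F) * Real.exp (F * x) - (mu + r) * Real.exp (r * x)) / (c * (F - r))))
        (fun x => (mu + F) / (c * (F - r)) * Real.exp ((F - s) * x)
          - (mu + r) / (c * (F - r)) * Real.exp ((r - s) * x)) (Ioi 0) := by
      intro x hx
      have hx' : ¬ x < 0 := not_lt.mpr (le_of_lt hx)
      have a1 : Real.exp ((F - s) * x) = Real.exp (-(s * x)) * Real.exp (F * x) := by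
        rw [← Real.exp_add]; congr 1; ring
      have a2 : Real.exp ((r - s) * x) = Real.exp (-(s * x)) * Real.exp (r * x) := by
        rw [← Real.exp_add]; congr 1; ring
      simp only [hx', if_false]
      rw [a1, a2]; ring
    refine ⟨?_, ?_, ?_⟩
    · intro h
      rw [h, sub_self] at hk
      have : c * ((s - F) * (s - r)) / (mu + s) ≠ 0 :=
        div_ne_zero (mul_ne_zero hc.ne' (mul_ne_zero h1 h2)) hms
      exact this hk.symm
    · exact (integrableOn_congr_fun e measurableSet_Ioi).2
        ((i1.const_mul _).sub (i2.const_mul _))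
    · rw [setIntegral_congr_fun measurableSet_Ioi e,
        integral_sub (i1.const_mul _) (i2.const_mul _), integral_const_mul, integral_const_mul,
        v1, v2, hk]
      have h3 : F - s ≠ 0 := by linarith
      have h4 : r - s ≠ 0 := by linarith
      have h5 : F - r ≠ 0 := by linarith
      simp only [mul_zero, Real.exp_zero]
      field_simp
      ring

open Classical in
/-- The `q`-scale function `W_q`: the function characterized by `IsScaleFunction`. -/
def scaleW (c lam mu q : ℝ) : ℝ → ℝ :=
  if h : ∃ W, IsScaleFunction c lam mu q W then h.choose else 0

lemma isScaleFunction_scaleW {c lam mu q : ℝ} (hc : 0 < c) (hlam : 0 < lam) (hmu : 0 < mu)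
    (hq : 0 < q) : IsScaleFunction c lam mu q (scaleW c lam mu q) := by
  have h := exists_isScaleFunction hc hlam hmu hq
  rw [scaleW, dif_pos h]
  exact h.choose_spec

/-- The distribution function of the claims on `[0, ∞)`; in the equations below the same formula
is used for every real argument. -/
def claimCdf (mu z : ℝ) : ℝ := 1 - Real.exp (-(mu * z))

/-- The survival function of the claims. -/
def claimTail (mu z : ℝ) : ℝ := 1 - claimCdf mu z

/-- The truncated mean `m(a) = ∫_0^a z mu e^{-mu z} dz`. -/
def truncMean (mu a : ℝ) : ℝ := ∫ z in (0 : ℝ)..a, z * (mu * Real.exp (-(mu * z)))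

/-- The expected scale after a jump, `C(x) = ∫_0^x W_q(x - y) ν̄(y) dy`, with the tail
`ν̄ = lam * claimTail` of the Lévy measure. -/
def jumpScale (c lam mu q x : ℝ) : ℝ :=
  ∫ z in (0 : ℝ)..x, scaleW c lam mu q (x - z) * (lam * claimTail mu z)

/-- The derivative `C'(b)` on `[0, ∞)` (the right derivative at `b = 0`). -/
def jumpScaleDeriv (c lam mu q b : ℝ) : ℝ := derivWithin (jumpScale c lam mu q) (Ici 0) b

/-- `γ(b) = 1 / C'(b)`. -/
def gam (c lam mu q b : ℝ) : ℝ := 1 / jumpScaleDeriv c lam mu q b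

/-- `θ(b) = W_q(b) / C'(b)`. -/
def theta (c lam mu q b : ℝ) : ℝ := scaleW c lam mu q b / jumpScaleDeriv c lam mu q b

/-- `j(b) = γ'(b) / (q θ'(b))`, with derivatives on `[0, ∞)`. -/
def jfun (c lam mu q b : ℝ) : ℝ :=
  derivWithin (gam c lam mu q) (Ici 0) b / (q * derivWithin (theta c lam mu q) (Ici 0) b)

/-- `η(b, a) = γ(b)/θ(b) - k F(a) / (mu θ(b)) - q (k a - P)`. -/
def eta (c lam mu q k P b a : ℝ) : ℝ :=
  gam c lam mu q b / theta c lam mu q b - k / (mu * theta c lam mu q b) * claimCdf mu a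
    - q * (k * a - P)

/-- `s(b) = (j(b) + P) / k`. -/
def sfun (c lam mu q k P b : ℝ) : ℝ := (jfun c lam mu q b + P) / k

/-- `η(b) = η(b, s(b))`. -/
def etaDiag (c lam mu q k P b : ℝ) : ℝ := eta c lam mu q k P b (sfun c lam mu q k P b)

/-- The principal branch `L₀ : [-1/e, ∞) → [-1, ∞)` of the Lambert function, the inverse of the
restriction of `z ↦ z e^z` to `[-1, ∞)`. -/
def lambertW0 : ℝ → ℝ := Function.invFunOn (fun z : ℝ => z * Real.exp z) (Ici (-1))

/-- `h(b) = 1/(q θ(b)) - (mu/k) (γ(b)/(q θ(b)) + P)`. -/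
def hfun (c lam mu q k P b : ℝ) : ℝ :=
  1 / (q * theta c lam mu q b) - mu / k * (gam c lam mu q b / (q * theta c lam mu q b) + P)

/-- `a(b) = (-h(b) + L₀(e^{h(b)} / (q θ(b)))) / mu`. -/
def afun (c lam mu q k P b : ℝ) : ℝ :=
  1 / mu * (-hfun c lam mu q k P b
    + lambertW0 (Real.exp (hfun c lam mu q k P b) / (q * theta c lam mu q b)))

end CramerLundberg

end

open CramerLundberg

/-!
The profit of the `(-a, 0, b)` policy is computed from the claim epochs. Along almost every
realization it is the sum over `n` of the profit of the `n`-th stage (the time between two claims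
together with the second of them), discounted by `killedDiscount`, which is `exp (-q t_n)` as long
as bankruptcy has not occurred (`hasSum_profit`). The reserve after the first `n` claims is
independent of the next waiting time and claim size. Hence, if a bounded function `v` on `[0, b]`
satisfies the renewal equation "expected profit of one stage plus expected discounted value of `v`
at its end equals `v`", the profit of the first `N` stages plus the discounted value of the reserve
at their end has constant expectation. The second summand is `O((lam / (lam + q)) ^ N)`, so the
expected profit from `x` is `v x` (`IsExponentialClaims.expectedProfit_eq`).

For exponential claims the overshoot below `0` is again exponential, and the renewal equation
becomes the homogeneous linear equation `κ(d/dx) v = q v` with one condition coming from the claims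
that overshoot and the condition `v'(b) = 1` at the barrier (`integral_stage_expValue`). The
solutions are the combinations of `exp (Φ x)` and `exp (r x)`, where `Φ` and `r` are the roots of
`κ = q`. Uniqueness of Laplace transforms (`eqOn_zero_of_laplace_eq_zero`) gives the scale function
in the same terms, and comparing the two yields the cost function (`expectedProfit_zero_eq`).

The optimality equations are calculus with this formula. Both partial derivatives of `J` are
positive multiples of a difference: `θ' (j - J)` in `b` and `J - (k a - P)` in `a`. The second
difference is `θ(b) η(b, a)` over a positive denominator (`costFun_sub`), and `η(b, a) = 0` is
`z e^z = e^h / (q θ)` for `z = mu a + h` (`eta_eq_zero_iff`).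
-/

noncomputable section

namespace CramerLundberg

/-! ### Uniqueness of Laplace transforms -/

/-- If all moments `∫ e^{-nx} ψ(x) dx` over the half-line vanish, then so does the integral of `ψ`
against every test function supported in the open half-line: substitute `u = e^{-x}` and
approximate by polynomials on `[0, 1]`. -/
lemma integral_testFunction_mul_eq_zero {ψ : ℝ → ℝ} (hψ : IntegrableOn ψ (Ioi 0))
    (hmom : ∀ n : ℕ, ∫ x in Ioi (0 : ℝ), Real.exp (-x) ^ n * ψ x = 0)
    {g : ℝ → ℝ} (hg : Continuous g) (hgc : HasCompactSupport g) (hg0 : g 0 = 0) :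
    ∫ x in Ioi (0 : ℝ), g x * ψ x = 0 := by
  have hbd : ∀ x ∈ Ioi (0 : ℝ), Real.exp (-x) ∈ Icc (0 : ℝ) 1 := fun x hx =>
    ⟨(Real.exp_pos _).le, Real.exp_le_one_iff.2 (by have := mem_Ioi.1 hx; linarith)⟩
  have hpowint : ∀ n : ℕ, IntegrableOn (fun x => Real.exp (-x) ^ n * ψ x) (Ioi 0) := by
    intro n
    refine hψ.bdd_mul (c := 1) (by fun_prop) ?_
    filter_upwards [ae_restrict_mem measurableSet_Ioi] with x hx
    rw [Real.norm_of_nonneg (by positivity)]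
    exact pow_le_one₀ (hbd x hx).1 (hbd x hx).2
  have hpolyeq : ∀ p : Polynomial ℝ, (fun x => p.eval (Real.exp (-x)) * ψ x)
      = fun x => ∑ i ∈ Finset.range (p.natDegree + 1),
        p.coeff i * (Real.exp (-x) ^ i * ψ x) := by
    intro p
    funext x
    rw [Polynomial.eval_eq_sum_range, Finset.sum_mul]
    exact Finset.sum_congr rfl fun i _ => by ring
  have hpolyint : ∀ p : Polynomial ℝ,
      IntegrableOn (fun x => p.eval (Real.exp (-x)) * ψ x) (Ioi 0) := by
    intro p
    rw [hpolyeq]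
    exact integrable_finsetSum _ fun i _ => (hpowint i).const_mul _
  have hpoly : ∀ p : Polynomial ℝ,
      ∫ x in Ioi (0 : ℝ), p.eval (Real.exp (-x)) * ψ x = 0 := by
    intro p
    rw [hpolyeq, integral_finsetSum _ fun i _ => (hpowint i).const_mul _]
    refine Finset.sum_eq_zero fun i _ => ?_
    rw [integral_const_mul, hmom, mul_zero]
  -- at `u = 0` the value is `g 0 = 0` since `Real.log 0 = 0`, which is also the limit there
  have hG : ContinuousOn (fun u => g (-Real.log u)) (Icc 0 1) := by
    intro u _
    rcases eq_or_ne u 0 with rfl | h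
    · refine ContinuousAt.continuousWithinAt ?_
      rw [continuousAt_iff_punctured_nhds]
      simp only [Real.log_zero, neg_zero, hg0]
      exact ((hgc.is_zero_at_infty).mono_left atTop_le_cocompact).comp
        (tendsto_neg_atBot_atTop.comp Real.tendsto_log_nhdsNE_zero)
    · exact (hg.continuousAt.comp (Real.continuousAt_log h).neg).continuousWithinAt
  obtain ⟨M, hM⟩ := hgc.exists_bound_of_continuous hg
  have hgint : IntegrableOn (fun x => g x * ψ x) (Ioi 0) :=
    hψ.bdd_mul (c := M) hg.aestronglyMeasurable (Eventually.of_forall hM)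
  by_contra hne
  set I := ∫ x in Ioi (0 : ℝ), g x * ψ x with hI
  set N := ∫ x in Ioi (0 : ℝ), ‖ψ x‖ with hN
  have hN0 : 0 ≤ N := integral_nonneg fun _ => norm_nonneg _
  have hIpos : 0 < |I| := abs_pos.2 hne
  obtain ⟨p, hp⟩ := exists_polynomial_near_of_continuousOn 0 1 _ hG (|I| / (N + 1)) (by positivity)
  have key : |I| ≤ |I| / (N + 1) * N := by
    have h1 : I = ∫ x in Ioi (0 : ℝ), (g x - p.eval (Real.exp (-x))) * ψ x := by
      simp_rw [sub_mul]
      rw [integral_sub hgint (hpolyint p), hpoly, sub_zero]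
    have h2 : ‖∫ x in Ioi (0 : ℝ), (g x - p.eval (Real.exp (-x))) * ψ x‖
        ≤ ∫ x in Ioi (0 : ℝ), |I| / (N + 1) * ‖ψ x‖ := by
      refine norm_integral_le_of_norm_le (hψ.norm.const_mul _) ?_
      filter_upwards [ae_restrict_mem measurableSet_Ioi] with x hx
      rw [norm_mul]
      refine mul_le_mul_of_nonneg_right ?_ (norm_nonneg _)
      have := hp _ (hbd x hx)
      rw [Real.log_exp, neg_neg] at this
      rw [Real.norm_eq_abs, abs_sub_comm]
      exact this.le
    rw [integral_const_mul, ← h1] at h2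
    exact h2
  have : |I| / (N + 1) * N < |I| := by
    rw [div_mul_eq_mul_div, div_lt_iff₀ (by positivity)]
    nlinarith
  linarith

/-- A function that is continuous on the half-line and whose Laplace transform vanishes for all
large arguments is zero. -/
lemma eqOn_zero_of_laplace_eq_zero {f : ℝ → ℝ} (hf : ContinuousOn f (Ici 0))
    (h : ∀ᶠ s in atTop, IntegrableOn (fun x => Real.exp (-(s * x)) * f x) (Ioi 0) ∧
      ∫ x in Ioi (0 : ℝ), Real.exp (-(s * x)) * f x = 0) :
    EqOn f 0 (Ici 0) := by
  obtain ⟨s₀, hs₀⟩ := eventually_atTop.1 h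
  set ψ : ℝ → ℝ := fun x => Real.exp (-(s₀ * x)) * f x with hψdef
  have hψ : IntegrableOn ψ (Ioi 0) := (hs₀ s₀ le_rfl).1
  have hmom : ∀ n : ℕ, ∫ x in Ioi (0 : ℝ), Real.exp (-x) ^ n * ψ x = 0 := by
    intro n
    refine Eq.trans ?_ (hs₀ (s₀ + n) (by simp)).2
    congr 1 with x
    rw [hψdef, ← Real.exp_nat_mul, ← mul_assoc, ← Real.exp_add]
    congr 2
    ring
  have hae : ∀ᵐ x, x ∈ Ioi (0 : ℝ) → ψ x = 0 := by
    refine isOpen_Ioi.ae_eq_zero_of_integral_contDiff_smul_eq_zero hψ.locallyIntegrableOn ?_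
    intro g hg hgc hgs
    have hout : ∀ x, x ∉ Ioi (0 : ℝ) → g x = 0 := fun x hx =>
      image_eq_zero_of_notMem_tsupport fun hx' => hx (hgs hx')
    rw [← setIntegral_eq_integral_of_forall_compl_eq_zero (s := Ioi 0)
      (fun x hx => by rw [hout x hx, zero_smul])]
    exact integral_testFunction_mul_eq_zero hψ hmom hg.continuous hgc (hout 0 (by simp))
  refine Measure.eqOn_of_ae_eq (μ := volume) ?_ hf continuousOn_const (by simp)
  rw [Measure.restrict_congr_set Ioi_ae_eq_Ici.symm]
  filter_upwards [(ae_restrict_iff' measurableSet_Ioi).2 hae] with x hx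
  simpa [hψdef, Real.exp_ne_zero] using hx

/-! ### The scale function for exponential claims -/

/-- `Φ` and `r` are the positive and the negative root of
`c s² + (c mu - lam - q) s - q mu = (mu + s) (κ(s) - q)`, expressed through their sum and product.
The bound `0 < mu + r` is a consequence for positive parameters, recorded for repeated use. -/
structure IsRootPair (c lam mu q Φ r : ℝ) : Prop where
  neg : r < 0
  pos : 0 < Φ
  mu_add_pos : 0 < mu + r
  sum : c * (Φ + r) = -(c * mu - lam - q)
  prod : c * (Φ * r) = -(q * mu)

lemma exists_isRootPair {c lam mu q : ℝ} (hc : 0 < c) (hlam : 0 < lam) (hmu : 0 < mu)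
    (hq : 0 < q) : ∃ Φ r, IsRootPair c lam mu q Φ r := by
  set B := c * mu - lam - q with hB
  set D := Real.sqrt (B ^ 2 + 4 * c * (q * mu)) with hD
  have hD2 : D ^ 2 = B ^ 2 + 4 * c * (q * mu) := Real.sq_sqrt (by positivity)
  have hpos : 0 < 4 * c * (q * mu) := by positivity
  have hBD : |B| < D := abs_lt_of_sq_lt_sq (by linarith) (Real.sqrt_nonneg _)
  obtain ⟨hB1, hB2⟩ := abs_lt.1 hBD
  refine ⟨(-B + D) / (2 * c), (-B - D) / (2 * c), ?_, ?_, ?_, ?_, ?_⟩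
  · exact div_neg_of_neg_of_pos (by linarith) (by positivity)
  · exact div_pos (by linarith) (by positivity)
  · have : D < 2 * c * mu - B := by
      refine lt_of_pow_lt_pow_left₀ 2 (by nlinarith [mul_pos hc hmu]) ?_
      rw [hD2, hB]
      nlinarith [mul_pos (mul_pos hc hmu) hlam]
    have h2 : mu + (-B - D) / (2 * c) = (2 * c * mu - B - D) / (2 * c) := by field_simp; ring
    rw [h2]
    exact div_pos (by linarith) (by positivity)
  · field_simp; ring
  · field_simp; nlinarith

section RootPair

variable {c lam mu q Φ r : ℝ}

lemma IsRootPair.gap_pos (h : IsRootPair c lam mu q Φ r) (hc : 0 < c) : 0 < c * (Φ - r) :=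
  mul_pos hc (by linarith [h.neg, h.pos])

lemma IsRootPair.mul_eq (h : IsRootPair c lam mu q Φ r) :
    c * ((mu + Φ) * (mu + r)) = lam * mu := by
  linear_combination mu * h.sum + h.prod

lemma IsRootPair.pos_root_eq (h : IsRootPair c lam mu q Φ r) :
    (lam + q - c * Φ) * (mu + Φ) = lam * mu := by
  linear_combination -Φ * h.sum + h.prod

lemma IsRootPair.neg_root_eq (h : IsRootPair c lam mu q Φ r) :
    (lam + q - c * r) * (mu + r) = lam * mu := by
  linear_combination -r * h.sum + h.prod

/-- The explicit form of the scale function on `[0, ∞)`, as an entire function of `x`. -/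
def expScale (c mu Φ r x : ℝ) : ℝ :=
  ((mu + Φ) * Real.exp (Φ * x) - (mu + r) * Real.exp (r * x)) / (c * (Φ - r))

/-- The explicit form of `C` on `[0, ∞)`. -/
def expJumpScale (c lam Φ r x : ℝ) : ℝ :=
  lam * (Real.exp (Φ * x) - Real.exp (r * x)) / (c * (Φ - r))

/-- The explicit form of `C'` on `[0, ∞)`. -/
def expJumpScaleDeriv (c lam Φ r x : ℝ) : ℝ :=
  lam * (Φ * Real.exp (Φ * x) - r * Real.exp (r * x)) / (c * (Φ - r))

lemma hasDerivAt_exp_mul (a x : ℝ) :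
    HasDerivAt (fun x => Real.exp (a * x)) (a * Real.exp (a * x)) x := by
  simpa [mul_comm] using ((hasDerivAt_id x).const_mul a).exp

lemma laplace_expScale (h : IsRootPair c lam mu q Φ r) (hc : 0 < c) (hmu : 0 < mu) {s : ℝ}
    (hs : Φ < s) :
    IntegrableOn (fun x => Real.exp (-(s * x)) * expScale c mu Φ r x) (Ioi 0) ∧
    ∫ x in Ioi (0 : ℝ), Real.exp (-(s * x)) * expScale c mu Φ r x
      = 1 / (laplaceExponent c lam mu s - q) := by
  have hs0 : 0 < s := h.pos.trans hs
  have hk : laplaceExponent c lam mu s - q = c * ((s - Φ) * (s - r)) / (mu + s) := by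
    have hms : mu + s ≠ 0 := by positivity
    rw [laplaceExponent_eq hmu hs0]
    field_simp
    linear_combination s * h.sum - h.prod
  have i1 := integrableOn_exp_mul_Ioi (a := Φ - s) (by linarith) 0
  have i2 := integrableOn_exp_mul_Ioi (a := r - s) (by linarith [h.neg]) 0
  have v1 := integral_exp_mul_Ioi (a := Φ - s) (by linarith) 0
  have v2 := integral_exp_mul_Ioi (a := r - s) (by linarith [h.neg]) 0
  have e : (fun x => Real.exp (-(s * x)) * expScale c mu Φ r x)
      = fun x => (mu + Φ) / (c * (Φ - r)) * Real.exp ((Φ - s) * x)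
          - (mu + r) / (c * (Φ - r)) * Real.exp ((r - s) * x) := by
    funext x
    rw [expScale, show (Φ - s) * x = -(s * x) + Φ * x by ring,
      show (r - s) * x = -(s * x) + r * x by ring, Real.exp_add, Real.exp_add]
    ring
  rw [e]
  refine ⟨(i1.const_mul _).sub (i2.const_mul _), ?_⟩
  rw [integral_sub (i1.const_mul _) (i2.const_mul _), integral_const_mul, integral_const_mul,
    v1, v2, hk]
  have h1 : Φ - s ≠ 0 := by linarith
  have h2 : r - s ≠ 0 := by linarith [h.neg]
  have h3 : s - Φ ≠ 0 := by linarith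
  have h4 : s - r ≠ 0 := by linarith [h.neg]
  have h5 : Φ - r ≠ 0 := by linarith [h.neg, h.pos]
  simp only [mul_zero, Real.exp_zero]
  field_simp
  ring

lemma continuous_expScale : Continuous (expScale c mu Φ r) := by
  unfold expScale; fun_prop

lemma scaleW_eq (h : IsRootPair c lam mu q Φ r) (hc : 0 < c) (hlam : 0 < lam) (hmu : 0 < mu)
    (hq : 0 < q) {x : ℝ} (hx : 0 ≤ x) : scaleW c lam mu q x = expScale c mu Φ r x := by
  have hW := isScaleFunction_scaleW hc hlam hmu hq
  have := eqOn_zero_of_laplace_eq_zero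
    (f := fun x => scaleW c lam mu q x - expScale c mu Φ r x)
    (hW.continuousOn.sub continuous_expScale.continuousOn) ?_ (mem_Ici.2 hx)
  · simpa [sub_eq_zero] using this
  · filter_upwards [hW.laplace, eventually_gt_atTop Φ] with s hs hsΦ
    obtain ⟨i2, e2⟩ := laplace_expScale h hc hmu hsΦ
    simp_rw [mul_sub]
    refine ⟨hs.2.1.sub i2, ?_⟩
    rw [integral_sub hs.2.1 i2, hs.2.2, e2, sub_self]

lemma claimTail_eq (mu z : ℝ) : claimTail mu z = Real.exp (-(mu * z)) := by
  simp [claimTail, claimCdf]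

lemma jumpScale_eq (h : IsRootPair c lam mu q Φ r) (hc : 0 < c) (hlam : 0 < lam) (hmu : 0 < mu)
    (hq : 0 < q) {x : ℝ} (hx : 0 ≤ x) : jumpScale c lam mu q x = expJumpScale c lam Φ r x := by
  have hcongr : jumpScale c lam mu q x
      = ∫ z in (0 : ℝ)..x, expScale c mu Φ r (x - z) * (lam * Real.exp (-(mu * z))) := by
    rw [jumpScale]
    refine intervalIntegral.integral_congr fun z hz => ?_
    rw [uIcc_of_le hx] at hz
    simp only [claimTail_eq]
    rw [scaleW_eq h hc hlam hmu hq (by linarith [hz.2])]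
  have hd : ∀ z ∈ uIcc 0 x, HasDerivAt
      (fun z => -lam / (c * (Φ - r)) * (Real.exp (Φ * x) * Real.exp (-(mu + Φ) * z)
        - Real.exp (r * x) * Real.exp (-(mu + r) * z)))
      (expScale c mu Φ r (x - z) * (lam * Real.exp (-(mu * z)))) z := by
    intro z _
    refine (((hasDerivAt_exp_mul (-(mu + Φ)) z).const_mul _).sub
      ((hasDerivAt_exp_mul (-(mu + r)) z).const_mul _)).const_mul _ |>.congr_deriv ?_
    rw [expScale, show Φ * (x - z) = Φ * x + -(Φ * z) by ring,
      show r * (x - z) = r * x + -(r * z) by ring,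
      show -(mu + Φ) * z = -(Φ * z) + -(mu * z) by ring,
      show -(mu + r) * z = -(r * z) + -(mu * z) by ring]
    simp only [Real.exp_add]
    ring
  rw [hcongr, intervalIntegral.integral_eq_sub_of_hasDerivAt hd
    (((continuous_expScale.comp (by fun_prop)).mul (by fun_prop)).intervalIntegrable _ _),
    ← Real.exp_add, ← Real.exp_add, expJumpScale,
    show Φ * x + -(mu + Φ) * x = r * x + -(mu + r) * x by ring]
  simp only [mul_zero, Real.exp_zero]
  ring

lemma hasDerivAt_expJumpScale (x : ℝ) :
    HasDerivAt (expJumpScale c lam Φ r) (expJumpScaleDeriv c lam Φ r x) x :=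
  (((hasDerivAt_exp_mul Φ x).sub (hasDerivAt_exp_mul r x)).const_mul lam).div_const _

lemma hasDerivAt_expScale (x : ℝ) : HasDerivAt (expScale c mu Φ r)
    (((mu + Φ) * (Φ * Real.exp (Φ * x)) - (mu + r) * (r * Real.exp (r * x))) / (c * (Φ - r))) x :=
  (((hasDerivAt_exp_mul Φ x).const_mul _).sub ((hasDerivAt_exp_mul r x).const_mul _)).div_const _

lemma hasDerivAt_expJumpScaleDeriv (x : ℝ) : HasDerivAt (expJumpScaleDeriv c lam Φ r)
    (lam * (Φ * (Φ * Real.exp (Φ * x)) - r * (r * Real.exp (r * x))) / (c * (Φ - r))) x :=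
  ((((hasDerivAt_exp_mul Φ x).const_mul _).sub
    ((hasDerivAt_exp_mul r x).const_mul _)).const_mul lam).div_const _

lemma expJumpScaleDeriv_pos (h : IsRootPair c lam mu q Φ r) (hc : 0 < c) (hlam : 0 < lam)
    (x : ℝ) : 0 < expJumpScaleDeriv c lam Φ r x :=
  div_pos (mul_pos hlam (by
    nlinarith [mul_pos h.pos (Real.exp_pos (Φ * x)), mul_pos (neg_pos.2 h.neg)
      (Real.exp_pos (r * x))])) (h.gap_pos hc)

lemma expScale_pos (h : IsRootPair c lam mu q Φ r) (hc : 0 < c)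
    {x : ℝ} (hx : 0 ≤ x) : 0 < expScale c mu Φ r x := by
  refine div_pos ?_ (h.gap_pos hc)
  have h1 : Real.exp (r * x) ≤ Real.exp (Φ * x) :=
    Real.exp_le_exp.2 (by nlinarith [h.neg, h.pos])
  nlinarith [Real.exp_pos (r * x), h.mu_add_pos, h.neg, h.pos]

lemma jumpScaleDeriv_eq (h : IsRootPair c lam mu q Φ r) (hc : 0 < c) (hlam : 0 < lam)
    (hmu : 0 < mu) (hq : 0 < q) {x : ℝ} (hx : 0 ≤ x) :
    jumpScaleDeriv c lam mu q x = expJumpScaleDeriv c lam Φ r x :=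
  ((hasDerivAt_expJumpScale x).hasDerivWithinAt.congr
    (fun _ hy => jumpScale_eq h hc hlam hmu hq hy)
    (jumpScale_eq h hc hlam hmu hq hx)).derivWithin (uniqueDiffOn_Ici 0 x hx)

lemma jumpScaleDeriv_pos (h : IsRootPair c lam mu q Φ r) (hc : 0 < c) (hlam : 0 < lam)
    (hmu : 0 < mu) (hq : 0 < q) {x : ℝ} (hx : 0 ≤ x) : 0 < jumpScaleDeriv c lam mu q x := by
  rw [jumpScaleDeriv_eq h hc hlam hmu hq hx]
  exact expJumpScaleDeriv_pos h hc hlam x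

lemma scaleW_pos (h : IsRootPair c lam mu q Φ r) (hc : 0 < c) (hlam : 0 < lam)
    (hmu : 0 < mu) (hq : 0 < q) {x : ℝ} (hx : 0 ≤ x) : 0 < scaleW c lam mu q x := by
  rw [scaleW_eq h hc hlam hmu hq hx]
  exact expScale_pos h hc hx

lemma theta_pos (h : IsRootPair c lam mu q Φ r) (hc : 0 < c) (hlam : 0 < lam)
    (hmu : 0 < mu) (hq : 0 < q) {x : ℝ} (hx : 0 ≤ x) : 0 < theta c lam mu q x :=
  div_pos (scaleW_pos h hc hlam hmu hq hx) (jumpScaleDeriv_pos h hc hlam hmu hq hx)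

lemma differentiableWithinAt_gam (h : IsRootPair c lam mu q Φ r) (hc : 0 < c) (hlam : 0 < lam)
    (hmu : 0 < mu) (hq : 0 < q) {x : ℝ} (hx : 0 ≤ x) :
    DifferentiableWithinAt ℝ (gam c lam mu q) (Ici 0) x := by
  have hd : DifferentiableWithinAt ℝ (fun x => 1 / expJumpScaleDeriv c lam Φ r x) (Ici 0) x :=
    ((hasDerivAt_const x 1).div (hasDerivAt_expJumpScaleDeriv x)
      (expJumpScaleDeriv_pos h hc hlam x).ne').differentiableAt.differentiableWithinAt
  exact hd.congr (fun y hy => by rw [gam, jumpScaleDeriv_eq h hc hlam hmu hq hy])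
    (by rw [gam, jumpScaleDeriv_eq h hc hlam hmu hq hx])

/-- `θ` is increasing: the numerator `W' C' - W C''` of `θ'` is a positive multiple of
`e^{(Φ + r) x}`. -/
lemma exists_hasDerivWithinAt_theta (h : IsRootPair c lam mu q Φ r) (hc : 0 < c)
    (hlam : 0 < lam) (hmu : 0 < mu) (hq : 0 < q) {x : ℝ} (hx : 0 ≤ x) :
    ∃ d, 0 < d ∧ HasDerivWithinAt (theta c lam mu q) d (Ici 0) x := by
  have hpos := expJumpScaleDeriv_pos h hc hlam x
  refine ⟨_, ?_, (((hasDerivAt_expScale (c := c) (mu := mu) x).div (hasDerivAt_expJumpScaleDeriv x)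
    hpos.ne').hasDerivWithinAt).congr
      (fun y hy => by
        rw [theta, jumpScaleDeriv_eq h hc hlam hmu hq hy, scaleW_eq h hc hlam hmu hq hy]; rfl)
      (by rw [theta, jumpScaleDeriv_eq h hc hlam hmu hq hx, scaleW_eq h hc hlam hmu hq hx]; rfl)⟩
  refine div_pos ?_ (pow_pos hpos 2)
  have hgap := h.gap_pos hc
  have hΦr : 0 < Φ - r := by linarith [h.neg, h.pos]
  have key : ((mu + Φ) * (Φ * Real.exp (Φ * x)) - (mu + r) * (r * Real.exp (r * x)))
        / (c * (Φ - r)) * expJumpScaleDeriv c lam Φ r x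
      - expScale c mu Φ r x * (lam * (Φ * (Φ * Real.exp (Φ * x)) - r * (r * Real.exp (r * x)))
        / (c * (Φ - r)))
      = lam * mu * (Φ - r) ^ 2 * (Real.exp (Φ * x) * Real.exp (r * x)) / (c * (Φ - r)) ^ 2 := by
    rw [expJumpScaleDeriv, expScale, div_mul_div_comm, div_mul_div_comm, ← sub_div, ← pow_two]
    congr 1
    ring
  rw [key]
  positivity

end RootPair

/-! ### The profit along one realization as a sum over the claims -/

/-- The discount factor at the `n`-th claim epoch, killed at bankruptcy: it is
`exp (-q t_n)` if none of the first `n` claims caused bankruptcy, and `0` otherwise. -/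
def killedDiscount (c q a b x : ℝ) (τ y : ℕ → ℝ) : ℕ → ℝ
  | 0 => 1
  | n + 1 => killedDiscount c q a b x τ y n *
      (if deficit c b x τ y n ≤ a then Real.exp (-(q * τ n)) else 0)

/-- The profit collected from one claim epoch up to and including the next, discounted to the
former: the reserve starts at `x`, the waiting time is `s` and the claim size is `y`. The barrier
is reached after the time `(b - x) / c`. -/
def stageProfit (c q k P a b x s y : ℝ) : ℝ :=
  c * (max 0 (Real.exp (-(q * ((b - x) / c))) - Real.exp (-(q * s))) / q)
    - k * (if y - min b (x + c * s) ≤ a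
        then max 0 (y - min b (x + c * s)) * Real.exp (-(q * s)) else 0)
    - P * (if y - min b (x + c * s) ≤ a then 0 else Real.exp (-(q * s)))

section Pathwise

variable {c q k P a b x : ℝ} {τ y : ℕ → ℝ}

lemma claimTime_zero : claimTime τ 0 = 0 := by simp [claimTime]

lemma claimTime_succ (n : ℕ) : claimTime τ (n + 1) = claimTime τ n + τ n := by
  simp [claimTime, Finset.sum_range_succ]

lemma claimTime_strictMono (hτ : ∀ n, 0 < τ n) : StrictMono (claimTime τ) :=
  strictMono_nat_of_lt_succ fun n => by rw [claimTime_succ]; linarith [hτ n]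

lemma claimTime_nonneg (hτ : ∀ n, 0 < τ n) (n : ℕ) : 0 ≤ claimTime τ n := by
  rw [← claimTime_zero (τ := τ)]
  exact (claimTime_strictMono hτ).monotone (Nat.zero_le n)

lemma tendsto_claimTime (hq : 0 < q) (hsum : Summable fun n => Real.exp (-(q * claimTime τ n))) :
    Tendsto (claimTime τ) atTop atTop := by
  have h1 := Real.tendsto_exp_comp_nhds_zero.1 hsum.tendsto_atTop_zero
  have h2 := (tendsto_neg_atBot_atTop.comp h1).const_mul_atTop (inv_pos.2 hq)
  refine h2.congr fun n => ?_
  simp only [Function.comp]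
  field_simp

lemma exists_claimTime_le_lt (ht : Tendsto (claimTime τ) atTop atTop)
    {t : ℝ} (h0 : 0 ≤ t) : ∃ n, claimTime τ n ≤ t ∧ t < claimTime τ (n + 1) := by
  have hex : ∃ n, t < claimTime τ n := (ht.eventually_gt_atTop t).exists
  classical
  obtain ⟨m, hm⟩ : ∃ m, Nat.find hex = m + 1 := by
    refine Nat.exists_eq_succ_of_ne_zero fun h => ?_
    have := Nat.find_spec hex
    rw [h, claimTime_zero] at this
    linarith
  refine ⟨m, not_lt.1 (Nat.find_min hex (by omega)), ?_⟩
  have := Nat.find_spec hex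
  rwa [hm] at this

lemma claimCount_eq (hτ : ∀ n, 0 < τ n) {t : ℝ} {n : ℕ} (h1 : claimTime τ n ≤ t)
    (h2 : t < claimTime τ (n + 1)) : claimCount τ t = n := by
  have : {m : ℕ | claimTime τ (m + 1) ≤ t} = Iio n := by
    ext m
    simp only [mem_ofPred_eq, mem_Iio]
    constructor
    · intro h
      have := (claimTime_strictMono hτ).lt_iff_lt.1 (h.trans_lt h2)
      omega
    · intro h
      exact ((claimTime_strictMono hτ).monotone (by omega : m + 1 ≤ n)).trans h1
  rw [claimCount, this, Set.ncard_Iio_nat]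

lemma reserveAfterClaim_nonneg (hx : 0 ≤ x) (n : ℕ) : 0 ≤ reserveAfterClaim c b x τ y n := by
  cases n with
  | zero => exact hx
  | succ n => exact le_max_left _ _

lemma reserveAfterClaim_le (hxb : x ≤ b) (hb : 0 ≤ b) (hy : ∀ n, 0 ≤ y n) (n : ℕ) :
    reserveAfterClaim c b x τ y n ≤ b := by
  cases n with
  | zero => exact hxb
  | succ n =>
    exact max_le hb ((sub_le_self _ (hy n)).trans (min_le_left _ _))

lemma bankruptcyTime_eq (hτ : ∀ n, 0 < τ n) {N : ℕ} (hN : a < deficit c b x τ y N)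
    (hmin : ∀ m < N, deficit c b x τ y m ≤ a) :
    bankruptcyTime c a b x τ y = ENNReal.ofReal (claimTime τ (N + 1)) := by
  refine le_antisymm (iInf₂_le N hN) (le_iInf₂ fun m hm => ENNReal.ofReal_le_ofReal ?_)
  refine (claimTime_strictMono hτ).monotone (Nat.succ_le_succ (not_lt.1 fun h => ?_))
  exact absurd (hmin m h) (not_le.2 hm)

lemma bankruptcyTime_eq_top (h : ∀ m, deficit c b x τ y m ≤ a) :
    bankruptcyTime c a b x τ y = ⊤ := by
  simp only [bankruptcyTime, iInf_eq_top]
  exact fun m hm => absurd (h m) (not_le.2 hm)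

lemma exists_first_deficit (h : ∃ m, a < deficit c b x τ y m) :
    ∃ N, a < deficit c b x τ y N ∧ ∀ m < N, deficit c b x τ y m ≤ a := by
  classical
  exact ⟨Nat.find h, Nat.find_spec h, fun m hm => not_lt.1 (Nat.find_min h hm)⟩

/-- Between the `n`-th and the next claim epoch, bankruptcy has not yet occurred exactly if none of
the first `n` claims caused it. -/
lemma ofReal_lt_bankruptcyTime_iff (hτ : ∀ n, 0 < τ n) {t : ℝ} {n : ℕ} (h1 : claimTime τ n ≤ t)
    (h2 : t < claimTime τ (n + 1)) :
    ENNReal.ofReal t < bankruptcyTime c a b x τ y ↔ ∀ m < n, deficit c b x τ y m ≤ a := by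
  have hmono := (claimTime_strictMono hτ).monotone
  have h0 : 0 ≤ t := (claimTime_nonneg hτ n).trans h1
  by_cases h : ∃ m, a < deficit c b x τ y m
  · obtain ⟨N, hN, hmin⟩ := exists_first_deficit h
    rw [bankruptcyTime_eq hτ hN hmin, ENNReal.ofReal_lt_ofReal_iff_of_nonneg h0]
    constructor
    · intro ht m hm
      refine hmin m (not_le.1 fun hle => ?_)
      linarith [hmono (by omega : N + 1 ≤ n)]
    · intro hall
      have : n ≤ N := not_lt.1 fun hlt => absurd (hall N hlt) (not_le.2 hN)
      exact h2.trans_le (hmono (by omega))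
  · push Not at h
    rw [bankruptcyTime_eq_top h]
    simp [h]

lemma killedDiscount_of_alive {n : ℕ} (h : ∀ m < n, deficit c b x τ y m ≤ a) :
    killedDiscount c q a b x τ y n = Real.exp (-(q * claimTime τ n)) := by
  induction n with
  | zero => simp [killedDiscount, claimTime_zero]
  | succ n ih =>
    rw [killedDiscount, ih fun m hm => h m (by omega), if_pos (h n (by omega)), ← Real.exp_add,
      claimTime_succ]
    ring_nf

lemma killedDiscount_of_not_alive {n : ℕ} (h : ¬ ∀ m < n, deficit c b x τ y m ≤ a) :
    killedDiscount c q a b x τ y n = 0 := by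
  induction n with
  | zero => simp at h
  | succ n ih =>
    rw [killedDiscount]
    by_cases hn : deficit c b x τ y n ≤ a
    · rw [ih, zero_mul]
      refine fun hall => h fun m hm => ?_
      rcases (Nat.lt_succ_iff_lt_or_eq.1 hm) with h' | rfl
      · exact hall m h'
      · exact hn
    · rw [if_neg hn, mul_zero]

lemma killedDiscount_nonneg (n : ℕ) : 0 ≤ killedDiscount c q a b x τ y n := by
  by_cases h : ∀ m < n, deficit c b x τ y m ≤ a
  · rw [killedDiscount_of_alive h]; positivity
  · rw [killedDiscount_of_not_alive h]

lemma killedDiscount_le (n : ℕ) :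
    killedDiscount c q a b x τ y n ≤ Real.exp (-(q * claimTime τ n)) := by
  by_cases h : ∀ m < n, deficit c b x τ y m ≤ a
  · rw [killedDiscount_of_alive h]
  · rw [killedDiscount_of_not_alive h]; positivity

lemma setIntegral_exp_neg_Ico (hq : 0 < q) (u v : ℝ) :
    ∫ t in Ico u v, Real.exp (-(q * t))
      = max 0 (Real.exp (-(q * u)) - Real.exp (-(q * v))) / q := by
  rcases le_total u v with h | h
  · rw [integral_Ico_eq_integral_Ioc, ← intervalIntegral.integral_of_le h,
      intervalIntegral.integral_eq_sub_of_hasDerivAt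
        (f := fun t => -(Real.exp (-q * t) / q)) ?_
        (Continuous.intervalIntegrable (by fun_prop) _ _),
      max_eq_right (sub_nonneg.2 (Real.exp_le_exp.2 (by nlinarith)))]
    · simp only [neg_mul]; ring
    · intro t _
      refine ((hasDerivAt_exp_mul (-q) t).div_const q).neg.congr_deriv ?_
      field_simp
  · rw [Ico_eq_empty (not_lt.2 h), Measure.restrict_empty, integral_zero_measure,
      max_eq_left (sub_nonpos.2 (Real.exp_le_exp.2 (by nlinarith))), zero_div]

/-- The dividend set restricted to the time between two successive claims. -/
lemma dividendSet_inter_Ico (hc : 0 < c) (hτ : ∀ n, 0 < τ n) {n : ℕ}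
    (hX : reserveAfterClaim c b x τ y n ≤ b) :
    {t | 0 ≤ t ∧ ENNReal.ofReal t < bankruptcyTime c a b x τ y ∧ reserve c b x τ y t = b}
        ∩ Ico (claimTime τ n) (claimTime τ (n + 1))
      = {_t | ∀ m < n, deficit c b x τ y m ≤ a} ∩
        Ico (claimTime τ n + (b - reserveAfterClaim c b x τ y n) / c) (claimTime τ (n + 1)) := by
  have hdiv : 0 ≤ (b - reserveAfterClaim c b x τ y n) / c := div_nonneg (by linarith) hc.le
  have hiff : ∀ t, (reserveAfterClaim c b x τ y n + c * (t - claimTime τ n) ≥ b ↔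
      claimTime τ n + (b - reserveAfterClaim c b x τ y n) / c ≤ t) := by
    intro t
    rw [← le_sub_iff_add_le', div_le_iff₀ hc]
    constructor <;> intro h <;> linarith
  ext t
  simp only [mem_inter_iff, mem_ofPred_eq, mem_Ico]
  constructor
  · rintro ⟨⟨_, hT, hr⟩, h1, h2⟩
    rw [reserve, claimCount_eq hτ h1 h2, min_eq_left_iff] at hr
    exact ⟨(ofReal_lt_bankruptcyTime_iff hτ h1 h2).1 hT, (hiff t).1 hr, h2⟩
  · rintro ⟨hT, h1', h2⟩
    have h1 : claimTime τ n ≤ t := by linarith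
    refine ⟨⟨(claimTime_nonneg hτ n).trans h1, (ofReal_lt_bankruptcyTime_iff hτ h1 h2).2 hT, ?_⟩,
      h1, h2⟩
    rw [reserve, claimCount_eq hτ h1 h2, min_eq_left_iff]
    exact (hiff t).2 h1'

lemma hasSum_dividends (hc : 0 < c) (hq : 0 < q) (hτ : ∀ n, 0 < τ n)
    (ht : Tendsto (claimTime τ) atTop atTop)
    (hX : ∀ n, reserveAfterClaim c b x τ y n ≤ b) :
    HasSum (fun n => killedDiscount c q a b x τ y n *
        (c * (max 0 (Real.exp (-(q * ((b - reserveAfterClaim c b x τ y n) / c)))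
          - Real.exp (-(q * τ n))) / q)))
      (∫ t, Real.exp (-(q * t)) ∂(dividendMeasure c a b x τ y)) := by
  set S := {t | 0 ≤ t ∧ ENNReal.ofReal t < bankruptcyTime c a b x τ y ∧
    reserve c b x τ y t = b} with hS
  set I : ℕ → Set ℝ := fun n => Ico (claimTime τ n) (claimTime τ (n + 1)) with hI
  have hUnion : S = ⋃ n, S ∩ I n := by
    rw [← inter_iUnion]
    refine (inter_eq_left.2 fun t hts => ?_).symm
    obtain ⟨n, h1, h2⟩ := exists_claimTime_le_lt ht hts.1
    exact mem_iUnion.2 ⟨n, h1, h2⟩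
  have hmeas : ∀ n, MeasurableSet (S ∩ I n) := by
    intro n
    rw [hS, hI, dividendSet_inter_Ico hc hτ (hX n)]
    exact (MeasurableSet.const _).inter measurableSet_Ico
  have hdisj : Pairwise (Function.onFun Disjoint fun n => S ∩ I n) := by
    intro m n hmn
    exact ((claimTime_strictMono hτ).monotone.pairwise_disjoint_on_Ico_succ hmn).mono
      inter_subset_right inter_subset_right
  have hint : IntegrableOn (fun t => Real.exp (-(q * t))) (⋃ n, S ∩ I n) := by
    rw [← hUnion]
    have := (integrableOn_Ici_iff_integrableOn_Ioi (μ := volume)).2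
      (integrableOn_exp_mul_Ioi (a := -q) (by linarith) 0)
    simp only [neg_mul] at this
    exact this.mono_set fun t hts => hts.1
  have hsum := (hasSum_integral_iUnion hmeas hdisj hint).mul_left c
  rw [← hUnion] at hsum
  rw [dividendMeasure, integral_smul_measure, ENNReal.toReal_ofReal hc.le, smul_eq_mul]
  refine hsum.congr_fun fun n => ?_
  rw [hS, hI, dividendSet_inter_Ico hc hτ (hX n)]
  by_cases h : ∀ m < n, deficit c b x τ y m ≤ a
  · have e1 : ∀ d, Real.exp (-(q * (claimTime τ n + d)))
        = Real.exp (-(q * claimTime τ n)) * Real.exp (-(q * d)) := by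
      intro d; rw [← Real.exp_add]; ring_nf
    have hmax : ∀ u : ℝ, max 0 (Real.exp (-(q * claimTime τ n)) * u)
        = Real.exp (-(q * claimTime τ n)) * max 0 u := by
      intro u; rw [mul_max_of_nonneg _ _ (Real.exp_pos _).le, mul_zero]
    have huniv : {_t : ℝ | ∀ m < n, deficit c b x τ y m ≤ a} = univ := by
      ext; simpa using h
    rw [killedDiscount_of_alive h, huniv, univ_inter, setIntegral_exp_neg_Ico hq, claimTime_succ,
      e1, e1, ← mul_sub, hmax]
    ring
  · have hempty : {_t : ℝ | ∀ m < n, deficit c b x τ y m ≤ a} = ∅ := by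
      ext; simpa using h
    rw [killedDiscount_of_not_alive h, hempty]
    simp

lemma hasSum_injections (hτ : ∀ n, 0 < τ n) (ha : 0 ≤ a)
    (hsum : Summable fun n => Real.exp (-(q * claimTime τ n))) :
    HasSum (fun n => killedDiscount c q a b x τ y n *
        (if deficit c b x τ y n ≤ a then max 0 (deficit c b x τ y n) * Real.exp (-(q * τ n))
          else 0))
      (∫ t, Real.exp (-(q * t)) ∂(injectionMeasure c a b x τ y)) := by
  have hterm : ∀ n, ((if ENNReal.ofReal (claimTime τ (n + 1)) < bankruptcyTime c a b x τ y
      then ENNReal.ofReal (deficit c b x τ y n) else 0)).toReal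
        * Real.exp (-(q * claimTime τ (n + 1)))
      = killedDiscount c q a b x τ y n * (if deficit c b x τ y n ≤ a
          then max 0 (deficit c b x τ y n) * Real.exp (-(q * τ n)) else 0) := by
    intro n
    have hd : killedDiscount c q a b x τ y n * (if deficit c b x τ y n ≤ a
          then max 0 (deficit c b x τ y n) * Real.exp (-(q * τ n)) else 0)
        = max 0 (deficit c b x τ y n) * killedDiscount c q a b x τ y (n + 1) := by
      rw [killedDiscount]; split_ifs <;> ring
    rw [hd]
    have hiff := ofReal_lt_bankruptcyTime_iff (c := c) (a := a) (b := b) (x := x) (y := y) hτ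
      (le_refl (claimTime τ (n + 1))) (claimTime_strictMono hτ (Nat.lt_succ_self (n + 1)))
    by_cases h : ∀ m < n + 1, deficit c b x τ y m ≤ a
    · rw [if_pos (hiff.2 h), killedDiscount_of_alive h, ENNReal.toReal_ofReal', max_comm]
    · rw [if_neg (mt hiff.1 h), killedDiscount_of_not_alive h]; simp
  have hle : ∀ n, (if deficit c b x τ y n ≤ a
      then max 0 (deficit c b x τ y n) * Real.exp (-(q * τ n)) else 0)
      ≤ a * Real.exp (-(q * τ n)) := by
    intro n
    split_ifs with h
    · exact mul_le_mul_of_nonneg_right (max_le ha h) (Real.exp_pos _).le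
    · positivity
  have key := hasSum_integral_sum_dirac (f := fun t => Real.exp (-(q * t)))
    (x := fun n => claimTime τ (n + 1))
    (c := fun n => if ENNReal.ofReal (claimTime τ (n + 1)) < bankruptcyTime c a b x τ y
      then ENNReal.ofReal (deficit c b x τ y n) else 0)
    (fun n => by split_ifs <;> simp) ?_
  · simp only [smul_eq_mul, hterm] at key
    exact key
  · simp only [Real.norm_of_nonneg (Real.exp_pos _).le, hterm]
    refine Summable.of_nonneg_of_le (fun n => ?_) (fun n => ?_)
      (((summable_nat_add_iff 1).2 hsum).mul_left a)
    · exact mul_nonneg (killedDiscount_nonneg n) (by split_ifs <;> positivity)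
    · calc _ ≤ Real.exp (-(q * claimTime τ n)) * (a * Real.exp (-(q * τ n))) :=
            mul_le_mul (killedDiscount_le n) (hle n) (by split_ifs <;> positivity)
              (Real.exp_pos _).le
        _ = a * Real.exp (-(q * claimTime τ (n + 1))) := by
          rw [claimTime_succ, mul_left_comm, ← Real.exp_add]; ring_nf

lemma hasSum_discount (hτ : ∀ n, 0 < τ n) :
    HasSum (fun n => killedDiscount c q a b x τ y n *
        (if deficit c b x τ y n ≤ a then 0 else Real.exp (-(q * τ n))))
      (discount q (bankruptcyTime c a b x τ y)) := by
  by_cases h : ∃ m, a < deficit c b x τ y m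
  · obtain ⟨N, hN, hmin⟩ := exists_first_deficit h
    have hval : discount q (bankruptcyTime c a b x τ y) = killedDiscount c q a b x τ y N *
        (if deficit c b x τ y N ≤ a then 0 else Real.exp (-(q * τ N))) := by
      rw [bankruptcyTime_eq hτ hN hmin, discount, if_neg ENNReal.ofReal_ne_top,
        ENNReal.toReal_ofReal (claimTime_nonneg hτ _), killedDiscount_of_alive hmin,
        if_neg (not_le.2 hN), ← Real.exp_add, claimTime_succ]
      ring_nf
    rw [hval]
    refine hasSum_single N ?_
    · intro n hn
      rcases lt_or_gt_of_ne hn with h' | h'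
      · rw [if_pos (hmin n h'), mul_zero]
      · rw [killedDiscount_of_not_alive fun hall => absurd (hall N h') (not_le.2 hN), zero_mul]
  · push Not at h
    rw [bankruptcyTime_eq_top h, discount, if_pos rfl]
    simp only [h, if_true, mul_zero]
    exact hasSum_zero

/-- The discounted profit is the sum of the profits of the single stages, each discounted to the
start of the stage and counted only up to bankruptcy. -/
theorem hasSum_profit (hc : 0 < c) (hq : 0 < q) (ha : 0 ≤ a) (hb : 0 ≤ b) (hxb : x ≤ b)
    (hτ : ∀ n, 0 < τ n) (hy : ∀ n, 0 ≤ y n)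
    (hsum : Summable fun n => Real.exp (-(q * claimTime τ n))) :
    HasSum (fun n => killedDiscount c q a b x τ y n *
        stageProfit c q k P a b (reserveAfterClaim c b x τ y n) (τ n) (y n))
      (profit c q k P a b x τ y) := by
  have h1 := hasSum_dividends (a := a) hc hq hτ (tendsto_claimTime hq hsum)
    (reserveAfterClaim_le (c := c) (τ := τ) hxb hb hy)
  have h2 := hasSum_injections (c := c) (b := b) (x := x) (y := y) hτ ha hsum
  have h3 := hasSum_discount (c := c) (q := q) (a := a) (b := b) (x := x) (y := y) hτ
  refine ((h1.sub (h2.mul_left k)).sub (h3.mul_left P)).congr_fun fun n => ?_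
  have hstage : stageProfit c q k P a b (reserveAfterClaim c b x τ y n) (τ n) (y n)
      = c * (max 0 (Real.exp (-(q * ((b - reserveAfterClaim c b x τ y n) / c)))
          - Real.exp (-(q * τ n))) / q)
        - k * (if deficit c b x τ y n ≤ a
            then max 0 (deficit c b x τ y n) * Real.exp (-(q * τ n)) else 0)
        - P * (if deficit c b x τ y n ≤ a then 0 else Real.exp (-(q * τ n))) := rfl
  rw [hstage]
  ring

end Pathwise

/-! ### Integrals against exponential laws -/

lemma integral_expMeasure {ρ : ℝ} (hρ : 0 < ρ) (f : ℝ → ℝ) :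
    ∫ y, f y ∂(expMeasure ρ) = ∫ y in Ioi (0 : ℝ), ρ * Real.exp (-(ρ * y)) * f y := by
  have h1 : expMeasure ρ
      = volume.withDensity fun x => ENNReal.ofReal (exponentialPDFReal ρ x) := rfl
  rw [h1, integral_withDensity_eq_integral_toReal_smul
    (measurable_exponentialPDFReal ρ).ennreal_ofReal
    (Eventually.of_forall fun _ => ENNReal.ofReal_lt_top), ← integral_Ici_eq_integral_Ioi,
    ← integral_indicator measurableSet_Ici]
  congr 1 with y
  change (exponentialPDF ρ y).toReal • f y = _
  rw [exponentialPDF_eq, indicator_apply]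
  by_cases hy : 0 ≤ y
  · rw [if_pos hy, if_pos (mem_Ici.2 hy), ENNReal.toReal_ofReal (by positivity), smul_eq_mul]
  · rw [if_neg hy, if_neg (by simpa using hy)]
    simp

lemma ae_expMeasure_pos {ρ : ℝ} : ∀ᵐ y ∂(expMeasure ρ), 0 < y := by
  have h1 : expMeasure ρ
      = volume.withDensity fun x => ENNReal.ofReal (exponentialPDFReal ρ x) := rfl
  rw [h1, ae_withDensity_iff (measurable_exponentialPDFReal ρ).ennreal_ofReal]
  filter_upwards [Measure.ae_ne volume (0 : ℝ)] with y hy0 hy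
  by_contra hneg
  exact hy (exponentialPDF_of_neg (lt_of_le_of_ne (not_lt.1 hneg) hy0))

lemma integral_exp_neg_expMeasure {q ρ : ℝ} (hq : 0 < q) (hρ : 0 < ρ) :
    ∫ s, Real.exp (-(q * s)) ∂(expMeasure ρ) = ρ / (ρ + q) := by
  have e : (fun s => ρ * Real.exp (-(ρ * s)) * Real.exp (-(q * s)))
      = fun s => ρ * Real.exp (-(ρ + q) * s) := by
    funext s
    rw [mul_assoc, ← Real.exp_add]; ring_nf
  rw [integral_expMeasure hρ, e, integral_const_mul, integral_exp_mul_Ioi (by linarith),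
    mul_zero, Real.exp_zero, neg_div_neg_eq, mul_one_div]

/-! ### The renewal equation of the value function -/

/-- What a claim of size `y`, arriving when the reserve is `u`, contributes when the policy has
value `v` afterwards: either the deficit, if there is one, is injected and the policy goes on, or
bankruptcy is declared. -/
def claimValue (k P a : ℝ) (v : ℝ → ℝ) (u y : ℝ) : ℝ :=
  if y - u ≤ a then v (max 0 (u - y)) - k * max 0 (y - u) else -P

lemma measurable_claimValue {k P a : ℝ} {v : ℝ → ℝ} (hv : Measurable v) :
    Measurable fun p : ℝ × ℝ => claimValue k P a v p.1 p.2 := by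
  refine Measurable.ite (measurableSet_le (by fun_prop) (by fun_prop)) ?_ (by fun_prop)
  fun_prop

lemma norm_claimValue_le {k P a b M u y : ℝ} {v : ℝ → ℝ} (ha : 0 ≤ a)
    (hM : ∀ u ∈ Icc 0 b, ‖v u‖ ≤ M) (hu : 0 ≤ u) (hub : u ≤ b) (hy : 0 ≤ y) :
    ‖claimValue k P a v u y‖ ≤ M + |k| * a + |P| := by
  have hM0 : 0 ≤ M := (norm_nonneg _).trans (hM 0 ⟨le_rfl, hu.trans hub⟩)
  rw [claimValue]
  split_ifs with h
  · have h1 := hM (max 0 (u - y)) ⟨le_max_left _ _, max_le (hu.trans hub) (by linarith)⟩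
    have h2 : ‖k * max 0 (y - u)‖ ≤ |k| * a := by
      rw [norm_mul, Real.norm_eq_abs, Real.norm_of_nonneg (le_max_left _ _)]
      exact mul_le_mul_of_nonneg_left (max_le ha h) (abs_nonneg k)
    linarith [norm_sub_le (v (max 0 (u - y))) (k * max 0 (y - u)), abs_nonneg P]
  · rw [norm_neg, Real.norm_eq_abs]
    have := mul_nonneg (abs_nonneg k) ha
    linarith

/-- The mean of `claimValue` for exponential claims. The overshoot over `u` is again exponential,
hence the factor `e^{-mu u}`. -/
lemma integral_claimValue {k P a mu u : ℝ} {v : ℝ → ℝ} (hmu : 0 < mu) (ha : 0 ≤ a) (hu : 0 ≤ u)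
    (hv : Continuous v) :
    ∫ y, claimValue k P a v u y ∂(expMeasure mu)
      = (∫ y in (0 : ℝ)..u, mu * Real.exp (-(mu * y)) * v (u - y))
        + Real.exp (-(mu * u)) * (v 0 * (1 - Real.exp (-(mu * a))) - k * truncMean mu a
          - P * Real.exp (-(mu * a))) := by
  rw [integral_expMeasure hmu]
  set f : ℝ → ℝ := fun y => mu * Real.exp (-(mu * y)) * claimValue k P a v u y with hf
  have e1 : EqOn f (fun y => mu * Real.exp (-(mu * y)) * v (u - y)) (Ioc 0 u) := by
    intro y hy
    simp only [hf, claimValue]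
    rw [if_pos (by linarith [hy.2]), max_eq_right (by linarith [hy.2]),
      max_eq_left (by linarith [hy.2]), mul_zero, sub_zero]
  have e2 : EqOn f (fun y => mu * Real.exp (-(mu * y)) * (v 0 - k * (y - u)))
      (Ioc u (u + a)) := by
    intro y hy
    simp only [hf, claimValue]
    rw [if_pos (by linarith [hy.2]), max_eq_left (by linarith [hy.1]),
      max_eq_right (by linarith [hy.1])]
  have e3 : EqOn f (fun y => -P * mu * Real.exp (-mu * y)) (Ioi (u + a)) := by
    intro y hy
    have := mem_Ioi.1 hy
    simp only [hf, claimValue]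
    rw [if_neg (by linarith), neg_mul mu]
    ring
  have c1 : Continuous fun y => mu * Real.exp (-(mu * y)) * v (u - y) := by fun_prop
  have c2 : Continuous fun y => mu * Real.exp (-(mu * y)) * (v 0 - k * (y - u)) := by fun_prop
  have i1 : IntegrableOn f (Ioc 0 u) :=
    (integrableOn_congr_fun e1 measurableSet_Ioc).2 c1.integrableOn_Ioc
  have i2 : IntegrableOn f (Ioc u (u + a)) :=
    (integrableOn_congr_fun e2 measurableSet_Ioc).2 c2.integrableOn_Ioc
  have i3 : IntegrableOn f (Ioi (u + a)) :=
    (integrableOn_congr_fun e3 measurableSet_Ioi).2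
      ((integrableOn_exp_mul_Ioi (by linarith) _).const_mul _)
  have i23 : IntegrableOn f (Ioi u) := by
    rw [← Ioc_union_Ioi_eq_Ioi (by linarith : u ≤ u + a)]
    exact i2.union i3
  rw [← Ioc_union_Ioi_eq_Ioi hu, setIntegral_union (Ioc_disjoint_Ioi le_rfl) measurableSet_Ioi
    i1 i23, ← Ioc_union_Ioi_eq_Ioi (by linarith : u ≤ u + a),
    setIntegral_union (Ioc_disjoint_Ioi le_rfl) measurableSet_Ioi i2 i3,
    setIntegral_congr_fun measurableSet_Ioc e1, setIntegral_congr_fun measurableSet_Ioc e2,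
    setIntegral_congr_fun measurableSet_Ioi e3, integral_const_mul,
    integral_exp_mul_Ioi (by linarith), ← intervalIntegral.integral_of_le hu,
    ← intervalIntegral.integral_of_le (by linarith : u ≤ u + a)]
  have hshift : ∫ y in u..(u + a), mu * Real.exp (-(mu * y)) * (v 0 - k * (y - u))
      = Real.exp (-(mu * u)) * (v 0 * (1 - Real.exp (-(mu * a))) - k * truncMean mu a) := by
    have h1 := intervalIntegral.integral_comp_add_right (a := 0) (b := a)
      (fun y => mu * Real.exp (-(mu * y)) * (v 0 - k * (y - u))) u
    rw [zero_add, add_comm a u] at h1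
    have h2 : ∀ z, mu * Real.exp (-(mu * (z + u))) * (v 0 - k * (z + u - u))
        = Real.exp (-(mu * u)) * (v 0 * (mu * Real.exp (-(mu * z)))
          - k * (z * (mu * Real.exp (-(mu * z))))) := by
      intro z
      rw [show -(mu * (z + u)) = -(mu * z) + -(mu * u) by ring, Real.exp_add]
      ring
    have h3 : ∫ z in (0 : ℝ)..a, mu * Real.exp (-(mu * z)) = 1 - Real.exp (-(mu * a)) := by
      rw [intervalIntegral.integral_eq_sub_of_hasDerivAt
        (fun z _ => hasDerivAt_neg_exp_mul_exp)
        (Continuous.intervalIntegrable (by fun_prop) _ _)]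
      simp
      ring
    rw [← h1]
    simp only [h2]
    rw [intervalIntegral.integral_const_mul, intervalIntegral.integral_sub
      (Continuous.intervalIntegrable (by fun_prop) _ _)
      (Continuous.intervalIntegrable (by fun_prop) _ _),
      intervalIntegral.integral_const_mul (v 0), h3, intervalIntegral.integral_const_mul k,
      truncMean]
  rw [hshift, show -mu * (u + a) = -(mu * u) + -(mu * a) by ring, Real.exp_add]
  field_simp
  ring

/-- Integration over the waiting time: if `c v' = (lam + q) v - lam K` on `[0, b]` and `v'(b) = 1`,
then `v` is the expected discounted sum of the dividends until the next claim and of the value `K`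
found at the claim. -/
lemma integral_waiting {c lam q b x : ℝ} {v v' K : ℝ → ℝ} (hc : 0 < c) (hlam : 0 < lam)
    (hq : 0 < q) (hx : x ≤ b) (hv : ∀ u, HasDerivAt v (v' u) u) (hK : Continuous K)
    (hode : ∀ u, c * v' u = (lam + q) * v u - lam * K u) (hb : v' b = 1) :
    ∫ s, (c * (max 0 (Real.exp (-(q * ((b - x) / c))) - Real.exp (-(q * s))) / q)
        + Real.exp (-(q * s)) * K (min b (x + c * s))) ∂(expMeasure lam) = v x := by
  rw [integral_expMeasure hlam]
  set s₀ := (b - x) / c with hs₀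
  have hs₀0 : 0 ≤ s₀ := div_nonneg (by linarith) hc.le
  have hxs : x + c * s₀ = b := by rw [hs₀]; field_simp; ring
  set f : ℝ → ℝ := fun s => lam * Real.exp (-(lam * s)) *
    (c * (max 0 (Real.exp (-(q * s₀)) - Real.exp (-(q * s))) / q)
      + Real.exp (-(q * s)) * K (min b (x + c * s))) with hf
  have e1 : EqOn f (fun s => lam * Real.exp (-(lam + q) * s) * K (x + c * s)) (Ioc 0 s₀) := by
    intro s hs
    have h1 : Real.exp (-(q * s₀)) ≤ Real.exp (-(q * s)) :=
      Real.exp_le_exp.2 (by nlinarith [hs.2])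
    have h2 : x + c * s ≤ b := by rw [← hxs]; nlinarith [hs.2]
    simp only [hf]
    rw [max_eq_left (by linarith), min_eq_right h2,
      show -(lam + q) * s = -(lam * s) + -(q * s) by ring, Real.exp_add]
    ring
  have e2 : EqOn f (fun s => lam * c / q * Real.exp (-(q * s₀)) * Real.exp (-lam * s)
      + lam * (K b - c / q) * Real.exp (-(lam + q) * s)) (Ioi s₀) := by
    intro s hs
    have hs' := mem_Ioi.1 hs
    have h1 : Real.exp (-(q * s)) ≤ Real.exp (-(q * s₀)) :=
      Real.exp_le_exp.2 (by nlinarith)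
    have h2 : b ≤ x + c * s := by rw [← hxs]; nlinarith
    simp only [hf]
    rw [max_eq_right (by linarith), min_eq_left h2,
      show -(lam + q) * s = -(lam * s) + -(q * s) by ring, Real.exp_add, neg_mul]
    field_simp
    ring
  have j1 := (integrableOn_exp_mul_Ioi (a := -lam) (by linarith) s₀).const_mul
    (lam * c / q * Real.exp (-(q * s₀)))
  have j2 := (integrableOn_exp_mul_Ioi (a := -(lam + q)) (by linarith) s₀).const_mul
    (lam * (K b - c / q))
  have c1 : Continuous fun s => lam * Real.exp (-(lam + q) * s) * K (x + c * s) := by fun_prop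
  have i1 : IntegrableOn f (Ioc 0 s₀) :=
    (integrableOn_congr_fun e1 measurableSet_Ioc).2 c1.integrableOn_Ioc
  have i2 : IntegrableOn f (Ioi s₀) :=
    (integrableOn_congr_fun e2 measurableSet_Ioi).2 (j1.add j2)
  have hFTC : ∫ s in (0 : ℝ)..s₀, lam * Real.exp (-(lam + q) * s) * K (x + c * s)
      = v x - Real.exp (-(lam + q) * s₀) * v b := by
    have hd : ∀ s ∈ uIcc 0 s₀, HasDerivAt (fun s => -(Real.exp (-(lam + q) * s) * v (x + c * s)))
        (lam * Real.exp (-(lam + q) * s) * K (x + c * s)) s := by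
      intro s _
      have h1 : HasDerivAt (fun s => x + c * s) c s := by
        simpa using ((hasDerivAt_id s).const_mul c).const_add x
      refine ((hasDerivAt_exp_mul _ s).mul ((hv (x + c * s)).comp s h1)).neg.congr_deriv ?_
      simp only [Function.comp]
      linear_combination -Real.exp (-(lam + q) * s) * hode (x + c * s)
    rw [intervalIntegral.integral_eq_sub_of_hasDerivAt hd (c1.intervalIntegrable _ _), hxs]
    simp
    ring
  rw [← Ioc_union_Ioi_eq_Ioi hs₀0, setIntegral_union (Ioc_disjoint_Ioi le_rfl) measurableSet_Ioi
    i1 i2, setIntegral_congr_fun measurableSet_Ioc e1, setIntegral_congr_fun measurableSet_Ioi e2,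
    ← intervalIntegral.integral_of_le hs₀0, hFTC, integral_add j1 j2, integral_const_mul,
    integral_const_mul, integral_exp_mul_Ioi (by linarith), integral_exp_mul_Ioi (by linarith),
    show -(lam + q) * s₀ = -(q * s₀) + -lam * s₀ by ring, Real.exp_add, neg_mul lam s₀]
  have hvb := hode b
  rw [hb] at hvb
  have hlq : lam + q ≠ 0 := by positivity
  generalize Real.exp (-(lam * s₀)) = E₁
  generalize Real.exp (-(q * s₀)) = E₂
  field_simp
  linear_combination q * E₁ * E₂ * hvb

/-- The general solution of the homogeneous equation `κ(d/dx) v = q v`. -/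
def expValue (A B Φ r x : ℝ) : ℝ := A * Real.exp (Φ * x) + B * Real.exp (r * x)

lemma hasDerivAt_expValue (A B Φ r x : ℝ) :
    HasDerivAt (expValue A B Φ r) (expValue (A * Φ) (B * r) Φ r x) x := by
  refine (((hasDerivAt_exp_mul Φ x).const_mul A).add
    ((hasDerivAt_exp_mul r x).const_mul B)).congr_deriv ?_
  rw [expValue]; ring

@[fun_prop]
lemma continuous_expValue (A B Φ r : ℝ) : Continuous (expValue A B Φ r) := by
  unfold expValue; fun_prop

lemma integral_exp_conv {mu ρ : ℝ} (h : mu + ρ ≠ 0) (u : ℝ) :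
    ∫ y in (0 : ℝ)..u, mu * Real.exp (-(mu * y)) * Real.exp (ρ * (u - y))
      = mu / (mu + ρ) * (Real.exp (ρ * u) - Real.exp (-(mu * u))) := by
  have hd : ∀ y ∈ uIcc 0 u, HasDerivAt
      (fun y => -(mu / (mu + ρ)) * (Real.exp (ρ * u) * Real.exp (-(mu + ρ) * y)))
      (mu * Real.exp (-(mu * y)) * Real.exp (ρ * (u - y))) y := by
    intro y _
    refine (((hasDerivAt_exp_mul _ y).const_mul _).const_mul _).congr_deriv ?_
    rw [show ρ * (u - y) = ρ * u + -(ρ * y) by ring,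
      show -(mu + ρ) * y = -(mu * y) + -(ρ * y) by ring, Real.exp_add, Real.exp_add]
    field_simp
  rw [intervalIntegral.integral_eq_sub_of_hasDerivAt hd
    (Continuous.intervalIntegrable (by fun_prop) _ _), ← Real.exp_add,
    show ρ * u + -(mu + ρ) * u = -(mu * u) by ring]
  simp only [mul_zero, Real.exp_zero]
  ring

/-- One step of the policy: the expected profit of a stage plus the expected discounted value at
its end is the value at its start. -/
theorem integral_stage_expValue {c lam mu q k P a b Φ r A B x : ℝ}
    (h : IsRootPair c lam mu q Φ r) (hc : 0 < c) (hlam : 0 < lam) (hmu : 0 < mu) (hq : 0 < q)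
    (ha : 0 ≤ a) (hx0 : 0 ≤ x) (hxb : x ≤ b)
    (h0 : (A + B) * (1 - Real.exp (-(mu * a))) - k * truncMean mu a - P * Real.exp (-(mu * a))
      = A * (mu / (mu + Φ)) + B * (mu / (mu + r)))
    (hb : expValue (A * Φ) (B * r) Φ r b = 1) :
    ∫ s, ∫ y, (c * (max 0 (Real.exp (-(q * ((b - x) / c))) - Real.exp (-(q * s))) / q)
        + Real.exp (-(q * s)) * claimValue k P a (expValue A B Φ r) (min b (x + c * s)) y)
        ∂(expMeasure mu) ∂(expMeasure lam) = expValue A B Φ r x := by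
  have hΦ : mu + Φ ≠ 0 := by linarith [h.pos]
  have hr : mu + r ≠ 0 := h.mu_add_pos.ne'
  have : IsProbabilityMeasure (expMeasure mu) := isProbabilityMeasure_expMeasure hmu
  set v := expValue A B Φ r with hv
  -- the terms with `exp (-mu u)` in the expected value at a claim cancel by `h0`
  set K := expValue (A * (mu / (mu + Φ))) (B * (mu / (mu + r))) Φ r with hK
  have hKint : ∀ u, 0 ≤ u → ∫ y, claimValue k P a v u y ∂(expMeasure mu) = K u := by
    intro u hu
    have hconv : ∫ y in (0 : ℝ)..u, mu * Real.exp (-(mu * y)) * v (u - y)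
        = A * (mu / (mu + Φ) * (Real.exp (Φ * u) - Real.exp (-(mu * u))))
          + B * (mu / (mu + r) * (Real.exp (r * u) - Real.exp (-(mu * u)))) := by
      rw [← integral_exp_conv hΦ, ← integral_exp_conv hr, ← intervalIntegral.integral_const_mul,
        ← intervalIntegral.integral_const_mul, ← intervalIntegral.integral_add
        (Continuous.intervalIntegrable (by fun_prop) _ _)
        (Continuous.intervalIntegrable (by fun_prop) _ _)]
      refine intervalIntegral.integral_congr fun y _ => ?_
      simp only [hv, expValue]
      ring
    have hv0 : v 0 = A + B := by simp [hv, expValue]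
    rw [integral_claimValue (v := v) hmu ha hu (continuous_expValue A B Φ r), hconv,
      hv0, h0, hK, expValue]
    ring
  have hode : ∀ u, c * expValue (A * Φ) (B * r) Φ r u = (lam + q) * v u - lam * K u := by
    intro u
    have h1 : lam * (mu / (mu + Φ)) = lam + q - c * Φ := by
      rw [← mul_div_assoc, div_eq_iff hΦ, h.pos_root_eq]
    have h2 : lam * (mu / (mu + r)) = lam + q - c * r := by
      rw [← mul_div_assoc, div_eq_iff hr, h.neg_root_eq]
    simp only [hv, hK, expValue]
    linear_combination A * Real.exp (Φ * u) * h1 + B * Real.exp (r * u) * h2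
  rw [← integral_waiting (v := v) hc hlam hq hxb (hasDerivAt_expValue A B Φ r)
    (continuous_expValue _ _ Φ r) hode hb]
  refine integral_congr_ae ?_
  filter_upwards [ae_expMeasure_pos] with s hs
  have hu : 0 ≤ min b (x + c * s) := le_min (hx0.trans hxb) (by positivity)
  obtain ⟨M, hM⟩ := isCompact_Icc.exists_bound_of_continuousOn
    (continuous_expValue A B Φ r).continuousOn (s := Icc 0 b)
  have hi : Integrable (fun y => claimValue k P a v (min b (x + c * s)) y) (expMeasure mu) := by
    refine Integrable.of_bound (C := M + |k| * a + |P|) ?_ ?_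
    · exact ((measurable_claimValue (continuous_expValue A B Φ r).measurable).comp
        (measurable_const.prodMk measurable_id)).aestronglyMeasurable
    · filter_upwards [ae_expMeasure_pos] with y hy
      exact norm_claimValue_le ha hM hu (min_le_left _ _) hy.le
  rw [integral_add (integrable_const _) (hi.const_mul _), integral_const, integral_const_mul,
    hKint _ hu]
  simp [hK]

/-! ### Series of integrable functions -/

section Series

variable {α : Type*} [MeasurableSpace α] {μ : Measure α}

lemma tsum_eLpNorm_one_ne_top {f : ℕ → α → ℝ} (hf : ∀ n, Integrable (f n) μ)
    (hs : Summable fun n => ∫ ω, ‖f n ω‖ ∂μ) : ∑' n, eLpNorm (f n) 1 μ ≠ ⊤ := by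
  have h : ∀ n, eLpNorm (f n) 1 μ = ENNReal.ofReal (∫ ω, ‖f n ω‖ ∂μ) := fun n => by
    rw [eLpNorm_one_eq_lintegral_enorm, ofReal_integral_norm_eq_lintegral_enorm (hf n)]
  simp only [h]
  exact hs.tsum_ofReal_ne_top

lemma integrable_and_hasSum_integral {f : ℕ → α → ℝ} {F : α → ℝ}
    (hf : ∀ n, Integrable (f n) μ) (hs : Summable fun n => ∫ ω, ‖f n ω‖ ∂μ)
    (hF : ∀ᵐ ω ∂μ, HasSum (fun n => f n ω) (F ω)) :
    Integrable F μ ∧ HasSum (fun n => ∫ ω, f n ω ∂μ) (∫ ω, F ω ∂μ) := by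
  have hm : AEStronglyMeasurable F μ := by
    refine aestronglyMeasurable_of_tendsto_ae atTop
      (f := fun N ω => ∑ n ∈ Finset.range N, f n ω) (fun N => ?_) ?_
    · exact Finset.aestronglyMeasurable_fun_sum _ fun n _ => (hf n).aestronglyMeasurable
    · filter_upwards [hF] with ω hω using hω.tendsto_sum_nat
  refine ⟨⟨hm, ?_⟩, ?_⟩
  · refine lt_of_le_of_lt (b := ∫⁻ ω, ∑' n, ‖f n ω‖ₑ ∂μ) (lintegral_mono_ae ?_) ?_
    · filter_upwards [hF] with ω hω
      rw [← hω.tsum_eq]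
      exact enorm_tsum_le_tsum_enorm
    · rw [lintegral_tsum fun n => (hf n).aestronglyMeasurable.enorm]
      have := tsum_eLpNorm_one_ne_top hf hs
      simp only [eLpNorm_one_eq_lintegral_enorm] at this
      exact this.lt_top
  · have h1 := hasSum_integral_of_summable_integral_norm hf hs
    rwa [integral_congr_ae (g := F) (by filter_upwards [hF] with ω hω using hω.tsum_eq)] at h1

end Series

/-! ### The stages as random variables -/

section Adapted

variable {c q a b x : ℝ} {n : ℕ}

lemma reserveAfterClaim_congr {τ τ' y y' : ℕ → ℝ} (hτ : ∀ i < n, τ i = τ' i)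
    (hy : ∀ i < n, y i = y' i) :
    reserveAfterClaim c b x τ y n = reserveAfterClaim c b x τ' y' n := by
  induction n with
  | zero => rfl
  | succ n ih =>
    rw [reserveAfterClaim, reserveAfterClaim, ih (fun i hi => hτ i (by omega))
      (fun i hi => hy i (by omega)), hτ n (by omega), hy n (by omega)]

lemma killedDiscount_congr {τ τ' y y' : ℕ → ℝ} (hτ : ∀ i < n, τ i = τ' i)
    (hy : ∀ i < n, y i = y' i) :
    killedDiscount c q a b x τ y n = killedDiscount c q a b x τ' y' n := by
  induction n with
  | zero => rfl
  | succ n ih =>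
    rw [killedDiscount, killedDiscount, ih (fun i hi => hτ i (by omega))
      (fun i hi => hy i (by omega)), deficit, deficit,
      reserveAfterClaim_congr (fun i hi => hτ i (by omega)) (fun i hi => hy i (by omega)),
      hτ n (by omega), hy n (by omega)]

lemma measurable_reserveAfterClaim :
    Measurable fun p : (ℕ → ℝ) × (ℕ → ℝ) => reserveAfterClaim c b x p.1 p.2 n := by
  induction n with
  | zero => exact measurable_const
  | succ n ih =>
    simp only [reserveAfterClaim]
    fun_prop

lemma measurable_killedDiscount :
    Measurable fun p : (ℕ → ℝ) × (ℕ → ℝ) => killedDiscount c q a b x p.1 p.2 n := by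
  induction n with
  | zero => exact measurable_const
  | succ n ih =>
    have hX := measurable_reserveAfterClaim (c := c) (b := b) (x := x) (n := n)
    simp only [killedDiscount, deficit]
    exact ih.mul (Measurable.ite (measurableSet_le (by fun_prop) (by fun_prop))
      (by fun_prop) measurable_const)

end Adapted

/-- The profit of a stage that starts with reserve `x`, has length `s` and ends with a claim of
size `y`, together with the discounted value `v` of the reserve at its end. -/
def stageValue (c q k P a b : ℝ) (v : ℝ → ℝ) (x s y : ℝ) : ℝ :=
  c * (max 0 (Real.exp (-(q * ((b - x) / c))) - Real.exp (-(q * s))) / q)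
    + Real.exp (-(q * s)) * claimValue k P a v (min b (x + c * s)) y

section StageValue

variable {c q k P a b : ℝ} {v : ℝ → ℝ}

lemma stageValue_eq (x s y : ℝ) : stageValue c q k P a b v x s y
    = stageProfit c q k P a b x s y
      + (if y - min b (x + c * s) ≤ a then Real.exp (-(q * s)) else 0)
        * v (max 0 (min b (x + c * s) - y)) := by
  rw [stageValue, stageProfit, claimValue]
  split_ifs <;> ring

lemma stageProfit_eq (x s y : ℝ) :
    stageProfit c q k P a b x s y = stageValue c q k P a b 0 x s y := by
  simp [stageValue_eq]

lemma measurable_stageValue (hv : Measurable v) :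
    Measurable fun p : ℝ × ℝ × ℝ => stageValue c q k P a b v p.1 p.2.1 p.2.2 := by
  have h := (measurable_claimValue (k := k) (P := P) (a := a) hv).comp
    (f := fun p : ℝ × ℝ × ℝ => (min b (p.1 + c * p.2.1), p.2.2)) (by fun_prop)
  simp only [stageValue]
  refine Measurable.add (by fun_prop) (Measurable.mul (by fun_prop) h)

lemma norm_stageValue_le {M x s y : ℝ} (hc : 0 < c) (hq : 0 < q) (ha : 0 ≤ a) (hx0 : 0 ≤ x)
    (hxb : x ≤ b) (hs : 0 ≤ s) (hy : 0 ≤ y) (hM : ∀ u ∈ Icc 0 b, ‖v u‖ ≤ M) :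
    ‖stageValue c q k P a b v x s y‖ ≤ c / q + (M + |k| * a + |P|) := by
  have hu : 0 ≤ min b (x + c * s) := le_min (hx0.trans hxb) (by positivity)
  have h1 := norm_claimValue_le (k := k) (P := P) ha hM hu (min_le_left _ _) hy
  have e1 : Real.exp (-(q * ((b - x) / c))) ≤ 1 := Real.exp_le_one_iff.2 (by
    have : 0 ≤ (b - x) / c := div_nonneg (by linarith) hc.le
    nlinarith)
  have e2 : Real.exp (-(q * s)) ≤ 1 := Real.exp_le_one_iff.2 (by nlinarith)
  have e3 := Real.exp_pos (-(q * s))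
  rw [stageValue]
  refine (norm_add_le _ _).trans (add_le_add ?_ ?_)
  · rw [Real.norm_of_nonneg (mul_nonneg hc.le (div_nonneg (le_max_left _ _) hq.le)),
      mul_div_assoc']
    refine div_le_div_of_nonneg_right ?_ hq.le
    have : max 0 (Real.exp (-(q * ((b - x) / c))) - Real.exp (-(q * s))) ≤ 1 :=
      max_le zero_le_one (by linarith)
    nlinarith
  · rw [norm_mul, Real.norm_of_nonneg e3.le]
    exact (mul_le_of_le_one_left (norm_nonneg _) e2).trans h1

end StageValue

/-! ### The expected profit -/

section Expectation

variable {Ω : Type*} [MeasurableSpace Ω] {Pr : Measure Ω}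
  {c lam mu q k P a b x : ℝ} {τ Y : ℕ → Ω → ℝ}

lemma IsExponentialClaims.ae_pos (hcl : IsExponentialClaims Pr lam mu τ Y) :
    ∀ᵐ ω ∂Pr, (∀ n, 0 < τ n ω) ∧ ∀ n, 0 < Y n ω := by
  refine (ae_all_iff.2 fun n => ?_).and (ae_all_iff.2 fun n => ?_)
  · exact ((hcl.law_waiting n).ae_iff
      (measurableSet_setOfPred.1 measurableSet_Ioi)).2 ae_expMeasure_pos
  · exact ((hcl.law_claim n).ae_iff
      (measurableSet_setOfPred.1 measurableSet_Ioi)).2 ae_expMeasure_pos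

lemma IsExponentialClaims.aemeasurable_path (hcl : IsExponentialClaims Pr lam mu τ Y) :
    AEMeasurable (fun ω => ((fun n => τ n ω, fun n => Y n ω) : (ℕ → ℝ) × (ℕ → ℝ))) Pr :=
  (aemeasurable_pi_lambda _ fun n => (hcl.law_waiting n).aemeasurable).prodMk
    (aemeasurable_pi_lambda _ fun n => (hcl.law_claim n).aemeasurable)

lemma IsExponentialClaims.integral_exp_claimTime (hcl : IsExponentialClaims Pr lam mu τ Y)
    (hlam : 0 < lam) (hq : 0 < q) (n : ℕ) :
    ∫ ω, Real.exp (-(q * claimTime (fun i => τ i ω) n)) ∂Pr = (lam / (lam + q)) ^ n := by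
  have hind : iIndepFun τ Pr := hcl.indep.precomp (g := Sum.inl) Sum.inl_injective
  have h1 := hind.mgf_sum₀ (t := -q) (fun i => (hcl.law_waiting i).aemeasurable) (Finset.range n)
  have h2 : ∀ i, mgf (τ i) Pr (-q) = lam / (lam + q) := by
    intro i
    rw [← integral_exp_neg_expMeasure hq hlam, ← (hcl.law_waiting i).integral_comp (by fun_prop)]
    simp [mgf]
  simp only [h2, Finset.prod_const, Finset.card_range] at h1
  rw [← h1]
  simp [mgf, claimTime]

lemma IsExponentialClaims.aemeasurable_claimTime (hcl : IsExponentialClaims Pr lam mu τ Y)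
    (n : ℕ) : AEMeasurable (fun ω => claimTime (fun i => τ i ω) n) Pr :=
  Finset.aemeasurable_fun_sum _ fun i _ => (hcl.law_waiting i).aemeasurable

lemma IsExponentialClaims.integrable_exp_claimTime [IsProbabilityMeasure Pr]
    (hcl : IsExponentialClaims Pr lam mu τ Y)
    (hq : 0 < q) (n : ℕ) :
    Integrable (fun ω => Real.exp (-(q * claimTime (fun i => τ i ω) n))) Pr := by
  refine Integrable.of_bound (C := 1) ?_ ?_
  · exact (((hcl.aemeasurable_claimTime n).const_mul q).neg.exp).aestronglyMeasurable
  · filter_upwards [hcl.ae_pos] with ω hω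
    rw [Real.norm_of_nonneg (Real.exp_pos _).le]
    exact Real.exp_le_one_iff.2 (by nlinarith [claimTime_nonneg hω.1 n])

lemma summable_discount_pow (hlam : 0 < lam) (hq : 0 < q) :
    Summable fun n : ℕ => (lam / (lam + q)) ^ n :=
  summable_geometric_of_lt_one (by positivity) ((div_lt_one (by positivity)).2 (by linarith))

lemma IsExponentialClaims.ae_summable [IsProbabilityMeasure Pr]
    (hcl : IsExponentialClaims Pr lam mu τ Y)
    (hlam : 0 < lam) (hq : 0 < q) :
    ∀ᵐ ω ∂Pr, Summable fun n => Real.exp (-(q * claimTime (fun i => τ i ω) n)) := by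
  have h := summable_norm_of_tsum_eLpNorm_ne_top (μ := Pr) (p := 1) le_rfl
    (f := fun n ω => Real.exp (-(q * claimTime (fun i => τ i ω) n)))
    (fun n => (hcl.integrable_exp_claimTime hq n).aestronglyMeasurable) ?_
  · simpa only [Real.norm_of_nonneg (Real.exp_pos _).le] using h
  · refine tsum_eLpNorm_one_ne_top (hcl.integrable_exp_claimTime hq) ?_
    simp only [Real.norm_of_nonneg (Real.exp_pos _).le, hcl.integral_exp_claimTime hlam hq]
    exact summable_discount_pow hlam hq

/-- The state after the first `n` claims is independent of the next waiting time and claim size. -/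
lemma IsExponentialClaims.indepFun_state (hcl : IsExponentialClaims Pr lam mu τ Y) (n : ℕ) :
    IndepFun (fun ω => (killedDiscount c q a b x (fun i => τ i ω) (fun i => Y i ω) n,
        reserveAfterClaim c b x (fun i => τ i ω) (fun i => Y i ω) n))
      (fun ω => (τ n ω, Y n ω)) Pr := by
  classical
  set S : Finset (ℕ ⊕ ℕ) := (Finset.range n).disjSum (Finset.range n) with hS
  set T : Finset (ℕ ⊕ ℕ) := {Sum.inl n, Sum.inr n} with hT
  have hdisj : Disjoint S T := by
    rw [Finset.disjoint_left]
    rintro (i | i) hi hi' <;> simp_all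
  have hmeas : ∀ i : ℕ ⊕ ℕ, AEMeasurable (Sum.elim τ Y i) Pr := by
    rintro (i | i)
    exacts [(hcl.law_waiting i).aemeasurable, (hcl.law_claim i).aemeasurable]
  have hind := iIndepFun.indepFun_finset₀ S T hdisj hcl.indep hmeas
  -- the first `n` waiting times and claim sizes, continued by zeros to full sequences
  set ext : (S → ℝ) → (ℕ → ℝ) × (ℕ → ℝ) := fun f =>
    (fun i => if h : Sum.inl i ∈ S then f ⟨_, h⟩ else 0,
      fun i => if h : Sum.inr i ∈ S then f ⟨_, h⟩ else 0) with hext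
  have hextm : Measurable ext := by
    refine Measurable.prodMk (measurable_pi_lambda _ fun i => ?_)
      (measurable_pi_lambda _ fun i => ?_)
    all_goals
      split_ifs
      · exact measurable_pi_apply _
      · exact measurable_const
  have hψ : Measurable fun f : T → ℝ =>
      (f ⟨Sum.inl n, by simp [hT]⟩, f ⟨Sum.inr n, by simp [hT]⟩) := by fun_prop
  have h := hind.comp (φ := fun f => (killedDiscount c q a b x (ext f).1 (ext f).2 n,
      reserveAfterClaim c b x (ext f).1 (ext f).2 n))
    ((measurable_killedDiscount.comp hextm).prodMk (measurable_reserveAfterClaim.comp hextm)) hψ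
  convert! h using 1
  funext ω
  have e1 : ∀ i < n, τ i ω = (ext fun j : S => Sum.elim τ Y j.1 ω).1 i := by
    intro i hi
    have : Sum.inl i ∈ S := by simpa [hS] using hi
    simp [hext, this]
  have e2 : ∀ i < n, Y i ω = (ext fun j : S => Sum.elim τ Y j.1 ω).2 i := by
    intro i hi
    have : Sum.inr i ∈ S := by simpa [hS] using hi
    simp [hext, this]
  simp only [Function.comp]
  rw [killedDiscount_congr e1 e2, reserveAfterClaim_congr e1 e2]

lemma IsExponentialClaims.map_pair [IsProbabilityMeasure Pr]
    (hcl : IsExponentialClaims Pr lam mu τ Y) (n : ℕ) :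
    Pr.map (fun ω => (τ n ω, Y n ω)) = (expMeasure lam).prod (expMeasure mu) := by
  have h := hcl.indep.indepFun (i := Sum.inl n) (j := Sum.inr n) (by simp)
  rw [← (hcl.law_waiting n).map_eq, ← (hcl.law_claim n).map_eq]
  exact h.map_prod_eq_prod_map_map (hcl.law_waiting n).aemeasurable (hcl.law_claim n).aemeasurable

variable {v : ℝ → ℝ} {M : ℝ}

lemma IsExponentialClaims.aemeasurable_state (hcl : IsExponentialClaims Pr lam mu τ Y) (n : ℕ) :
    AEMeasurable (fun ω => (killedDiscount c q a b x (fun i => τ i ω) (fun i => Y i ω) n,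
        reserveAfterClaim c b x (fun i => τ i ω) (fun i => Y i ω) n)) Pr :=
  (measurable_killedDiscount.comp_aemeasurable hcl.aemeasurable_path).prodMk
    (measurable_reserveAfterClaim.comp_aemeasurable hcl.aemeasurable_path)

lemma IsExponentialClaims.aemeasurable_pair (hcl : IsExponentialClaims Pr lam mu τ Y) (n : ℕ) :
    AEMeasurable (fun ω => (τ n ω, Y n ω)) Pr :=
  (hcl.law_waiting n).aemeasurable.prodMk (hcl.law_claim n).aemeasurable

lemma IsExponentialClaims.ae_norm_stage_le (hcl : IsExponentialClaims Pr lam mu τ Y)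
    (hc : 0 < c) (hq : 0 < q) (ha : 0 ≤ a) (hx0 : 0 ≤ x) (hxb : x ≤ b)
    (hM : ∀ u ∈ Icc 0 b, ‖v u‖ ≤ M) (n : ℕ) :
    ∀ᵐ ω ∂Pr, ‖killedDiscount c q a b x (fun i => τ i ω) (fun i => Y i ω) n *
        stageValue c q k P a b v (reserveAfterClaim c b x (fun i => τ i ω) (fun i => Y i ω) n)
          (τ n ω) (Y n ω)‖
      ≤ (c / q + (M + |k| * a + |P|)) * Real.exp (-(q * claimTime (fun i => τ i ω) n)) := by
  filter_upwards [hcl.ae_pos] with ω hω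
  rw [norm_mul, Real.norm_of_nonneg (killedDiscount_nonneg n), mul_comm]
  refine mul_le_mul (norm_stageValue_le hc hq ha (reserveAfterClaim_nonneg hx0 n)
    (reserveAfterClaim_le hxb (hx0.trans hxb) (fun i => (hω.2 i).le) n) (hω.1 n).le (hω.2 n).le hM)
    (killedDiscount_le n) (killedDiscount_nonneg n) ?_
  have hM0 : 0 ≤ M := (norm_nonneg _).trans (hM 0 ⟨le_rfl, hx0.trans hxb⟩)
  positivity

lemma IsExponentialClaims.integrable_stage [IsProbabilityMeasure Pr]
    (hcl : IsExponentialClaims Pr lam mu τ Y)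
    (hc : 0 < c) (hq : 0 < q) (ha : 0 ≤ a) (hx0 : 0 ≤ x) (hxb : x ≤ b)
    (hv : Measurable v) (hM : ∀ u ∈ Icc 0 b, ‖v u‖ ≤ M) (n : ℕ) :
    Integrable (fun ω => killedDiscount c q a b x (fun i => τ i ω) (fun i => Y i ω) n *
        stageValue c q k P a b v (reserveAfterClaim c b x (fun i => τ i ω) (fun i => Y i ω) n)
          (τ n ω) (Y n ω)) Pr := by
  refine Integrable.mono' ((hcl.integrable_exp_claimTime hq n).const_mul _) ?_
    (hcl.ae_norm_stage_le hc hq ha hx0 hxb hM n)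
  exact ((measurable_killedDiscount.comp_aemeasurable hcl.aemeasurable_path).mul
    ((measurable_stageValue hv).comp_aemeasurable
      ((measurable_reserveAfterClaim.comp_aemeasurable hcl.aemeasurable_path).prodMk
        (hcl.aemeasurable_pair n)))).aestronglyMeasurable

/-- Conditioning on the state after the first `n` claims. -/
lemma IsExponentialClaims.integral_stage [IsProbabilityMeasure Pr]
    (hcl : IsExponentialClaims Pr lam mu τ Y)
    (hc : 0 < c) (hlam : 0 < lam) (hmu : 0 < mu) (hq : 0 < q) (ha : 0 ≤ a) (hx0 : 0 ≤ x)
    (hxb : x ≤ b) (hv : Measurable v) (hM : ∀ u ∈ Icc 0 b, ‖v u‖ ≤ M)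
    (hren : ∀ z ∈ Icc 0 b,
      ∫ s, ∫ y, stageValue c q k P a b v z s y ∂(expMeasure mu) ∂(expMeasure lam) = v z) (n : ℕ) :
    ∫ ω, killedDiscount c q a b x (fun i => τ i ω) (fun i => Y i ω) n *
        stageValue c q k P a b v (reserveAfterClaim c b x (fun i => τ i ω) (fun i => Y i ω) n)
          (τ n ω) (Y n ω) ∂Pr
      = ∫ ω, killedDiscount c q a b x (fun i => τ i ω) (fun i => Y i ω) n *
        v (reserveAfterClaim c b x (fun i => τ i ω) (fun i => Y i ω) n) ∂Pr := by
  have : IsProbabilityMeasure (expMeasure lam) := isProbabilityMeasure_expMeasure hlam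
  have : IsProbabilityMeasure (expMeasure mu) := isProbabilityMeasure_expMeasure hmu
  set Z : Ω → ℝ × ℝ := fun ω => (killedDiscount c q a b x (fun i => τ i ω) (fun i => Y i ω) n,
    reserveAfterClaim c b x (fun i => τ i ω) (fun i => Y i ω) n) with hZ
  have hZm : AEMeasurable Z Pr := hcl.aemeasurable_state n
  have hWm := hcl.aemeasurable_pair n
  have hlaw := (hcl.indepFun_state (c := c) (q := q) (a := a) (b := b) (x := x) n
    ).map_prod_eq_prod_map_map hZm hWm
  rw [hcl.map_pair] at hlaw
  set F : (ℝ × ℝ) × (ℝ × ℝ) → ℝ :=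
    fun p => p.1.1 * stageValue c q k P a b v p.1.2 p.2.1 p.2.2 with hF
  have hFm : Measurable F := (by fun_prop : Measurable fun p : (ℝ × ℝ) × (ℝ × ℝ) => p.1.1).mul
    ((measurable_stageValue (c := c) (q := q) (k := k) (P := P) (a := a) (b := b) hv).comp
      (f := fun p : (ℝ × ℝ) × (ℝ × ℝ) => (p.1.2, p.2)) (by fun_prop))
  have hint : Integrable F ((Pr.map Z).prod ((expMeasure lam).prod (expMeasure mu))) := by
    rw [← hlaw, integrable_map_measure hFm.aestronglyMeasurable (hZm.prodMk hWm)]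
    exact hcl.integrable_stage hc hq ha hx0 hxb hv hM n
  have h1 : ∫ ω, F (Z ω, (τ n ω, Y n ω)) ∂Pr
      = ∫ p, ∫ w, F (p, w) ∂((expMeasure lam).prod (expMeasure mu)) ∂(Pr.map Z) := by
    rw [← integral_prod _ hint, ← hlaw, integral_map (hZm.prodMk hWm) hFm.aestronglyMeasurable]
  have h2 := integral_map hZm (hFm.stronglyMeasurable.integral_prod_right'
    (ν := (expMeasure lam).prod (expMeasure mu))).aestronglyMeasurable
  refine h1.trans (h2.trans (integral_congr_ae ?_))
  filter_upwards [hcl.ae_pos] with ω hω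
  have hX0 : 0 ≤ (Z ω).2 := reserveAfterClaim_nonneg hx0 n
  have hXb : (Z ω).2 ≤ b := reserveAfterClaim_le hxb (hx0.trans hxb) (fun i => (hω.2 i).le) n
  have hi : Integrable (fun w : ℝ × ℝ => stageValue c q k P a b v (Z ω).2 w.1 w.2)
      ((expMeasure lam).prod (expMeasure mu)) := by
    refine Integrable.of_bound (C := c / q + (M + |k| * a + |P|)) ?_ ?_
    · exact ((measurable_stageValue hv).comp
        (measurable_const.prodMk measurable_id)).aestronglyMeasurable
    · filter_upwards [Measure.quasiMeasurePreserving_fst.ae (ae_expMeasure_pos (ρ := lam)),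
        Measure.quasiMeasurePreserving_snd.ae (ae_expMeasure_pos (ρ := mu))] with w h1 h2
      exact norm_stageValue_le hc hq ha hX0 hXb h1.le h2.le hM
  simp only [hF]
  rw [integral_const_mul, integral_prod _ hi, hren _ ⟨hX0, hXb⟩]

/-- The expected profit is the bounded solution `v` of the renewal equation: the discounted value
of the state after `n` claims plus the profit collected so far has constant expectation, and the
former tends to `0`. -/
theorem IsExponentialClaims.expectedProfit_eq [IsProbabilityMeasure Pr]
    (hcl : IsExponentialClaims Pr lam mu τ Y)
    (hc : 0 < c) (hlam : 0 < lam) (hmu : 0 < mu) (hq : 0 < q) (ha : 0 ≤ a) (hx0 : 0 ≤ x)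
    (hxb : x ≤ b) (hv : Measurable v) (hM : ∀ u ∈ Icc 0 b, ‖v u‖ ≤ M)
    (hren : ∀ z ∈ Icc 0 b,
      ∫ s, ∫ y, stageValue c q k P a b v z s y ∂(expMeasure mu) ∂(expMeasure lam) = v z) :
    Integrable (fun ω => profit c q k P a b x (fun n => τ n ω) (fun n => Y n ω)) Pr ∧
    expectedProfit Pr τ Y c q k P a b x = v x := by
  set d : ℕ → Ω → ℝ := fun n ω => killedDiscount c q a b x (fun i => τ i ω) (fun i => Y i ω) n
    with hd
  set X : ℕ → Ω → ℝ := fun n ω => reserveAfterClaim c b x (fun i => τ i ω) (fun i => Y i ω) n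
    with hX
  set S : ℕ → Ω → ℝ := fun n ω => d n ω * stageProfit c q k P a b (X n ω) (τ n ω) (Y n ω) with hS
  have hS0 : ∀ n, S n = fun ω => d n ω * stageValue c q k P a b 0 (X n ω) (τ n ω) (Y n ω) := by
    intro n; funext ω; simp only [hS, stageProfit_eq]
  have h0 : ∀ u ∈ Icc 0 b, ‖(0 : ℝ → ℝ) u‖ ≤ 0 := by simp
  have hSint : ∀ n, Integrable (S n) Pr := by
    intro n
    rw [hS0]
    exact hcl.integrable_stage hc hq ha hx0 hxb measurable_zero h0 n
  have hSsum : Summable fun n => ∫ ω, ‖S n ω‖ ∂Pr := by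
    refine Summable.of_nonneg_of_le (fun n => integral_nonneg fun _ => norm_nonneg _) (fun n => ?_)
      ((summable_discount_pow hlam hq).mul_left (c / q + (0 + |k| * a + |P|)))
    rw [← hcl.integral_exp_claimTime hlam hq, ← integral_const_mul]
    refine integral_mono_ae (hSint n).norm ((hcl.integrable_exp_claimTime hq n).const_mul _) ?_
    rw [hS0]
    exact hcl.ae_norm_stage_le hc hq ha hx0 hxb h0 n
  obtain ⟨hint, hsum⟩ := integrable_and_hasSum_integral hSint hSsum
    (F := fun ω => profit c q k P a b x (fun n => τ n ω) (fun n => Y n ω)) (by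
      filter_upwards [hcl.ae_pos, hcl.ae_summable hlam hq] with ω hω hω'
      exact hasSum_profit hc hq ha (hx0.trans hxb) hxb hω.1 (fun n => (hω.2 n).le) hω')
  refine ⟨hint, ?_⟩
  have hdvbd : ∀ n, ∀ᵐ ω ∂Pr, ‖d n ω * v (X n ω)‖
      ≤ M * Real.exp (-(q * claimTime (fun i => τ i ω) n)) := by
    intro n
    filter_upwards [hcl.ae_pos] with ω hω
    rw [norm_mul, Real.norm_of_nonneg (killedDiscount_nonneg n), mul_comm]
    have h1 := hM (X n ω) ⟨reserveAfterClaim_nonneg hx0 n,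
      reserveAfterClaim_le hxb (hx0.trans hxb) (fun i => (hω.2 i).le) n⟩
    exact mul_le_mul h1 (killedDiscount_le n) (killedDiscount_nonneg n) ((norm_nonneg _).trans h1)
  have hdv : ∀ n, Integrable (fun ω => d n ω * v (X n ω)) Pr := by
    intro n
    refine Integrable.mono' ((hcl.integrable_exp_claimTime hq n).const_mul M) ?_ (hdvbd n)
    exact ((measurable_killedDiscount.comp_aemeasurable hcl.aemeasurable_path).mul
      (hv.comp_aemeasurable
        (measurable_reserveAfterClaim.comp_aemeasurable
          hcl.aemeasurable_path))).aestronglyMeasurable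
  have hstep : ∀ n, ∫ ω, S n ω ∂Pr
      = (∫ ω, d n ω * v (X n ω) ∂Pr) - ∫ ω, d (n + 1) ω * v (X (n + 1) ω) ∂Pr := by
    intro n
    rw [← hcl.integral_stage (k := k) (P := P) hc hlam hmu hq ha hx0 hxb hv hM hren n,
      ← integral_sub (hcl.integrable_stage hc hq ha hx0 hxb hv hM n) (hdv (n + 1))]
    congr 1 with ω
    have hd' : d (n + 1) ω = d n ω * (if Y n ω - min b (X n ω + c * τ n ω) ≤ a
        then Real.exp (-(q * τ n ω)) else 0) := rfl
    have hX' : X (n + 1) ω = max 0 (min b (X n ω + c * τ n ω) - Y n ω) := rfl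
    change d n ω * stageProfit c q k P a b (X n ω) (τ n ω) (Y n ω)
      = d n ω * stageValue c q k P a b v (X n ω) (τ n ω) (Y n ω) - d (n + 1) ω * v (X (n + 1) ω)
    rw [hd', hX', stageValue_eq]
    ring
  have hlim : Tendsto (fun n => ∫ ω, d n ω * v (X n ω) ∂Pr) atTop (𝓝 0) := by
    refine squeeze_zero_norm (fun n => ?_)
      (by simpa using (summable_discount_pow hlam hq).tendsto_atTop_zero.const_mul M)
    rw [← hcl.integral_exp_claimTime hlam hq, ← integral_const_mul]
    exact norm_integral_le_of_norm_le ((hcl.integrable_exp_claimTime hq n).const_mul M) (hdvbd n)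
  have hpartial : ∀ N, ∑ n ∈ Finset.range N, ∫ ω, S n ω ∂Pr
      = v x - ∫ ω, d N ω * v (X N ω) ∂Pr := by
    intro N
    simp only [hstep]
    rw [Finset.sum_range_sub']
    simp [hd, hX, killedDiscount, reserveAfterClaim]
  refine tendsto_nhds_unique hsum.tendsto_sum_nat ?_
  simp only [hpartial]
  simpa using hlim.const_sub (v x)

end Expectation

/-! ### The cost function -/

/-- The solution of the renewal equation is `J Z_q + (k m(a) + P F̄(a) + F̄(a) J) C` with
`Z_q = 1 + q ∫ W_q`, where `J`, its value at `0`, is fixed by the condition that the derivative at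
the barrier be `1`. -/
theorem expectedProfit_zero_eq {Ω : Type*} [MeasurableSpace Ω] {Pr : Measure Ω}
    [IsProbabilityMeasure Pr] {c lam mu q k P a b Φ r : ℝ} {τ Y : ℕ → Ω → ℝ}
    (hcl : IsExponentialClaims Pr lam mu τ Y) (h : IsRootPair c lam mu q Φ r)
    (hc : 0 < c) (hlam : 0 < lam) (hmu : 0 < mu) (hq : 0 < q) (ha : 0 ≤ a) (hb : 0 ≤ b) :
    Integrable (fun ω => profit c q k P a b 0 (fun n => τ n ω) (fun n => Y n ω)) Pr ∧
    expectedProfit Pr τ Y c q k P a b 0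
      = (1 - jumpScaleDeriv c lam mu q b * (k * truncMean mu a + P * claimTail mu a))
        / (claimTail mu a * jumpScaleDeriv c lam mu q b + q * scaleW c lam mu q b) := by
  have hW := expScale_pos h hc hb
  have hC := expJumpScaleDeriv_pos h hc hlam b
  rw [jumpScaleDeriv_eq h hc hlam hmu hq hb, scaleW_eq h hc hlam hmu hq hb, claimTail_eq]
  set E := Real.exp (-(mu * a)) with hE
  have hE0 : 0 < E := Real.exp_pos _
  set κ := k * truncMean mu a + P * E with hκ
  set J := (1 - expJumpScaleDeriv c lam Φ r b * κ)
    / (E * expJumpScaleDeriv c lam Φ r b + q * expScale c mu Φ r b) with hJ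
  have hden : 0 < E * expJumpScaleDeriv c lam Φ r b + q * expScale c mu Φ r b := by positivity
  have hJeq : J * (q * expScale c mu Φ r b) + (κ + E * J) * expJumpScaleDeriv c lam Φ r b = 1 := by
    have := (eq_div_iff hden.ne').1 hJ
    linear_combination this
  set L := κ + E * J with hL
  have hgap : Φ - r ≠ 0 := by linarith [h.neg, h.pos]
  have hΦ : mu + Φ ≠ 0 := by linarith [h.pos]
  have hr : mu + r ≠ 0 := h.mu_add_pos.ne'
  -- the coefficients of `J Z_q + L C` with respect to `exp (Φ x)` and `exp (r x)`
  set A := -(J * (r * (mu + Φ))) / (mu * (Φ - r)) + L * lam / (c * (Φ - r)) with hA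
  set B := J * (Φ * (mu + r)) / (mu * (Φ - r)) - L * lam / (c * (Φ - r)) with hB
  have hAB : A + B = J := by rw [hA, hB]; field_simp; ring
  have h0 : (A + B) * (1 - E) - k * truncMean mu a - P * E
      = A * (mu / (mu + Φ)) + B * (mu / (mu + r)) := by
    have h1 : A * (mu / (mu + Φ)) + B * (mu / (mu + r)) = J - L := by
      have h2 : lam * mu / (c * (Φ - r)) * (1 / (mu + Φ) - 1 / (mu + r)) = -1 := by
        rw [← h.mul_eq]; field_simp; ring
      have h3 : A * (mu / (mu + Φ)) + B * (mu / (mu + r))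
          = J + L * (lam * mu / (c * (Φ - r)) * (1 / (mu + Φ) - 1 / (mu + r))) := by
        rw [hA, hB]; field_simp; ring
      rw [h3, h2]; ring
    rw [h1, hAB, hL, hκ]; ring
  have hbd : expValue (A * Φ) (B * r) Φ r b = 1 := by
    have hp : q / c = -(Φ * r) / mu := by
      field_simp; linear_combination h.prod
    have h2 : expValue (A * Φ) (B * r) Φ r b
        = J * (q * expScale c mu Φ r b) + L * expJumpScaleDeriv c lam Φ r b := by
      have h3 : q * expScale c mu Φ r b = q / c * (((mu + Φ) * Real.exp (Φ * b)
          - (mu + r) * Real.exp (r * b)) / (Φ - r)) := by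
        rw [expScale]; field_simp
      rw [h3, hp, expValue, expJumpScaleDeriv, hA, hB]
      field_simp
      ring
    rw [h2, hJeq]
  obtain ⟨M, hM⟩ := isCompact_Icc.exists_bound_of_continuousOn
    (continuous_expValue A B Φ r).continuousOn (s := Icc 0 b)
  have key := hcl.expectedProfit_eq (k := k) (P := P) hc hlam hmu hq ha le_rfl hb
    (continuous_expValue A B Φ r).measurable hM
    (fun z hz => integral_stage_expValue h hc hlam hmu hq ha hz.1 hz.2 h0 hbd)
  refine ⟨key.1, key.2.trans ?_⟩
  simp [expValue, hAB]

lemma truncMean_eq {mu : ℝ} (hmu : 0 < mu) (a : ℝ) :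
    truncMean mu a = (1 - Real.exp (-(mu * a))) / mu - a * Real.exp (-(mu * a)) := by
  have hd : ∀ z ∈ uIcc 0 a, HasDerivAt
      (fun z => (1 - Real.exp (-mu * z)) / mu - z * Real.exp (-mu * z))
      (z * (mu * Real.exp (-(mu * z)))) z := by
    intro z _
    refine ((((hasDerivAt_exp_mul (-mu) z).const_sub 1).div_const mu).sub
      ((hasDerivAt_id z).mul (hasDerivAt_exp_mul (-mu) z))).congr_deriv ?_
    simp only [id]
    rw [neg_mul mu z]
    field_simp
    ring
  rw [truncMean, intervalIntegral.integral_eq_sub_of_hasDerivAt hd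
    (Continuous.intervalIntegrable (by fun_prop) _ _)]
  simp

/-- The cost function as a function of the injection threshold `a`; the parameters `g` and `t`
stand for `γ(b)` and `θ(b)`. -/
def costFun (mu q k P g t a : ℝ) : ℝ :=
  (g - k * truncMean mu a - P * claimTail mu a) / (q * t + claimTail mu a)

section Cost

variable {c lam mu q k P g t a : ℝ}

lemma costFun_den_pos (hq : 0 < q) (ht : 0 < t) : 0 < q * t + claimTail mu a := by
  rw [claimTail_eq]; positivity

lemma costFun_sub (hmu : 0 < mu) (hq : 0 < q) (ht : 0 < t) :
    costFun mu q k P g t a - (k * a - P)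
      = t * (g / t - k / (mu * t) * claimCdf mu a - q * (k * a - P))
        / (q * t + claimTail mu a) := by
  have hden := costFun_den_pos (mu := mu) (a := a) hq ht
  rw [costFun, eq_div_iff hden.ne', sub_mul, div_mul_cancel₀ _ hden.ne', truncMean_eq hmu,
    claimTail_eq, claimCdf]
  field_simp
  ring

lemma hasDerivAt_costFun (hmu : 0 < mu) (hq : 0 < q) (ht : 0 < t) :
    HasDerivAt (costFun mu q k P g t)
      (mu * claimTail mu a * (costFun mu q k P g t a - (k * a - P))
        / (q * t + claimTail mu a)) a := by
  have hden := costFun_den_pos (mu := mu) (a := a) hq ht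
  have h1 : HasDerivAt (truncMean mu) (a * (mu * Real.exp (-(mu * a)))) a :=
    intervalIntegral.integral_hasDerivAt_right (Continuous.intervalIntegrable (by fun_prop) _ _)
      (Continuous.stronglyMeasurableAtFilter (by fun_prop) _ _) (by fun_prop)
  have h2 : HasDerivAt (claimTail mu) (-(mu * claimTail mu a)) a := by
    have e : claimTail mu = fun a => Real.exp (-mu * a) := by
      funext z; rw [claimTail_eq, neg_mul]
    rw [e]
    simpa using hasDerivAt_exp_mul (-mu) a
  refine (((h1.const_mul k).const_sub g).sub (h2.const_mul P)).div (h2.const_add (q * t))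
    hden.ne' |>.congr_deriv ?_
  rw [claimTail_eq] at hden
  simp only [costFun, claimTail_eq, Pi.sub_apply]
  field_simp
  ring

/-- Where the value equals `k a - P`, the cost function attains its maximum over all thresholds,
by `1 - e^{-x} ≤ x`. -/
lemma costFun_le (hmu : 0 < mu) (hq : 0 < q) (hk : 0 < k) (ht : 0 < t) {A : ℝ}
    (hA : g / t - k / (mu * t) * claimCdf mu A - q * (k * A - P) = 0) :
    costFun mu q k P g t a ≤ k * A - P := by
  have hden := costFun_den_pos (mu := mu) (a := a) hq ht
  have hA' : g = k / mu * claimCdf mu A + q * t * (k * A - P) := by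
    field_simp at hA ⊢
    linear_combination hA
  rw [costFun, div_le_iff₀ hden, truncMean_eq hmu, claimTail_eq, hA', claimCdf]
  have h1 : Real.exp (-(mu * a)) - Real.exp (-(mu * A)) ≤ mu * (A - a) * Real.exp (-(mu * a)) := by
    have h2 := Real.add_one_le_exp (-(mu * (A - a)))
    have h3 : Real.exp (-(mu * A)) = Real.exp (-(mu * (A - a))) * Real.exp (-(mu * a)) := by
      rw [← Real.exp_add]; ring_nf
    rw [h3]
    nlinarith [Real.exp_pos (-(mu * a))]
  have h4 := mul_le_mul_of_nonneg_left h1 (div_pos hk hmu).le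
  have h5 : k / mu * (mu * (A - a) * Real.exp (-(mu * a)))
      = k * (A - a) * Real.exp (-(mu * a)) := by field_simp
  rw [h5] at h4
  have h6 : k * ((1 - Real.exp (-(mu * a))) / mu - a * Real.exp (-(mu * a)))
      = k / mu * (1 - Real.exp (-(mu * a))) - k * a * Real.exp (-(mu * a)) := by ring
  rw [h6]
  nlinarith

end Cost

/-! ### The Lambert function -/

lemma eq_lambertW0_iff {y : ℝ} (hy : 0 < y) (z : ℝ) : z = lambertW0 y ↔ z * Real.exp z = y := by
  have hex : y ∈ (fun z : ℝ => z * Real.exp z) '' Ici (-1) := by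
    have hcont : ContinuousOn (fun z : ℝ => z * Real.exp z) (Icc 0 y) := by fun_prop
    obtain ⟨z, hz, hzy⟩ := intermediate_value_Icc hy.le hcont
      (show y ∈ Icc _ _ by
        refine ⟨by simpa using hy.le, ?_⟩
        nlinarith [Real.add_one_le_exp y])
    exact ⟨z, mem_Ici.2 (by linarith [hz.1]), hzy⟩
  have hspec : lambertW0 y * Real.exp (lambertW0 y) = y := Function.invFunOn_eq hex
  refine ⟨fun hz => hz ▸ hspec, fun hz => ?_⟩
  have hpos : ∀ w : ℝ, w * Real.exp w = y → 0 < w := fun w hw =>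
    pos_of_mul_pos_left (hw ▸ hy) (Real.exp_pos w).le
  have hlt : ∀ u w : ℝ, 0 < u → u < w → u * Real.exp u < w * Real.exp w := fun u w hu huw =>
    mul_lt_mul'' huw (Real.exp_lt_exp.2 huw) hu.le (Real.exp_pos u).le
  rcases lt_trichotomy z (lambertW0 y) with h | h | h
  · linarith [hlt _ _ (hpos _ hz) h]
  · exact h
  · linarith [hlt _ _ (hpos _ hspec) h]

/-! ### The optimality equations -/

section Optimality

variable {c lam mu q k P a b : ℝ}

lemma eta_eq_zero_iff (hmu : 0 < mu) (hq : 0 < q) (hk : 0 < k) (ht : 0 < theta c lam mu q b) :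
    eta c lam mu q k P b a = 0 ↔ a = afun c lam mu q k P b := by
  set t := theta c lam mu q b with ht'
  set h := hfun c lam mu q k P b with hh
  have hy : 0 < Real.exp h / (q * t) := by positivity
  have h1 : a = afun c lam mu q k P b ↔ mu * a + h = lambertW0 (Real.exp h / (q * t)) := by
    rw [afun, ← hh, ← ht', one_div, eq_inv_mul_iff_mul_eq₀ hmu.ne']
    constructor <;> intro h <;> linarith
  rw [h1, eq_lambertW0_iff hy]
  have h2 : (mu * a + h) * Real.exp (mu * a + h) - Real.exp h / (q * t)
      = -(mu / (k * q)) * Real.exp (mu * a + h) * eta c lam mu q k P b a := by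
    have h3 : Real.exp h = Real.exp (mu * a + h) * Real.exp (-(mu * a)) := by
      rw [← Real.exp_add]; ring_nf
    rw [h3]
    have h4 : h = 1 / (q * t) - mu / k * (gam c lam mu q b / (q * t) + P) := hh
    rw [eta, ← ht', claimCdf]
    generalize Real.exp (mu * a + h) = X
    rw [h4]
    field_simp
    ring
  rw [← sub_eq_zero (b := Real.exp h / (q * t)), h2]
  have h5 : -(mu / (k * q)) * Real.exp (mu * a + h) ≠ 0 :=
    mul_ne_zero (neg_ne_zero.2 (by positivity)) (Real.exp_ne_zero _)
  rw [mul_eq_zero, or_iff_right h5]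

lemma eta_strictAnti (hmu : 0 < mu) (hq : 0 < q) (hk : 0 < k) (ht : 0 < theta c lam mu q b) :
    StrictAnti (eta c lam mu q k P b) := by
  intro u w huw
  have h1 : Real.exp (-(mu * w)) ≤ Real.exp (-(mu * u)) := Real.exp_le_exp.2 (by nlinarith)
  have h2 : q * (k * u) < q * (k * w) := by gcongr
  have h3 : k / (mu * theta c lam mu q b) * claimCdf mu u
      ≤ k / (mu * theta c lam mu q b) * claimCdf mu w :=
    mul_le_mul_of_nonneg_left (by rw [claimCdf, claimCdf]; linarith) (by positivity)
  rw [eta, eta]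
  linarith

end Optimality

end CramerLundberg

end

theorem mainTheorem3 {Ω : Type*} [MeasurableSpace Ω] (Pr : Measure Ω) [IsProbabilityMeasure Pr]
    (c lam mu q k P : ℝ) (hc : 0 < c) (hlam : 0 < lam) (hmu : 0 < mu) (hq : 0 < q) (hk : 1 ≤ k)
    (τ Y : ℕ → Ω → ℝ) (hclaims : IsExponentialClaims Pr lam mu τ Y) :
    let J : ℝ → ℝ → ℝ := fun a b => expectedProfit Pr τ Y c q k P a b 0
    let W : ℝ → ℝ := scaleW c lam mu q
    let C' : ℝ → ℝ := jumpScaleDeriv c lam mu q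
    let γ : ℝ → ℝ := gam c lam mu q
    let θ : ℝ → ℝ := theta c lam mu q
    let j : ℝ → ℝ := jfun c lam mu q
    let η : ℝ → ℝ → ℝ := eta c lam mu q k P
    let h : ℝ → ℝ := hfun c lam mu q k P
    let A : ℝ → ℝ := afun c lam mu q k P
    -- 1. the cost function
    (∀ a b : ℝ, 0 ≤ a → 0 ≤ b →
      Integrable (fun ω => profit c q k P a b 0 (fun n => τ n ω) (fun n => Y n ω)) Pr ∧
      0 < C' b ∧
      J a b = (1 - C' b * (k * truncMean mu a + P * claimTail mu a))
        / (claimTail mu a * C' b + q * W b) ∧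
      J a b = (γ b - k * truncMean mu a - P * claimTail mu a) / (q * θ b + claimTail mu a)) ∧
    -- 2. the optimality equation in `b`
    (∀ a b : ℝ, 0 ≤ a → 0 ≤ b →
      DifferentiableWithinAt ℝ γ (Ici 0) b ∧ DifferentiableWithinAt ℝ θ (Ici 0) b ∧
      0 < derivWithin θ (Ici 0) b ∧
      (HasDerivWithinAt (fun b' => J a b') 0 (Ici 0) b ↔ J a b = j b)) ∧
    -- 3. the optimality equation in `a`
    (∀ a b : ℝ, 0 < a → 0 ≤ b →
      (HasDerivAt (fun a' => J a' b) 0 a ↔ J a b - (k * a - P) = 0) ∧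
      (HasDerivAt (fun a' => J a' b) 0 a ↔ η b a = 0)) ∧
    -- 4. its solution for fixed `b`
    (-(c / q) ≤ P → ∀ b : ℝ, 0 ≤ b →
      (∀ a : ℝ, η b a = 0 ↔ a = A b) ∧
      (0 < A b ↔ 0 < 1 / (q * W b) + P) ∧
      (0 ≤ P → 0 < A b) ∧
      (0 ≤ A b →
        IsMaxOn (fun a => J a b) (Ici 0) (A b) ∧
        J (A b) b
          = k / mu * (-h b + lambertW0 (1 / (q * θ b) * Real.exp (h b))) - P)) ∧
    -- 5. the special case `b = 0`
    (let c' : ℝ := c + q * P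
     let δ : ℝ → ℝ := fun a => c' - k * (a * q + lam / mu * (1 - Real.exp (-(mu * a))))
     let g : ℝ := lam / q - mu / (k * q) * c'
     (∀ a : ℝ, η 0 a = δ a) ∧
     g = h 0 ∧
     (-(c / q) ≤ P → ∀ a : ℝ, δ a = 0 ↔ mu * a = -g + lambertW0 (lam / q * Real.exp g)) ∧
     (0 < c' → 0 < -g + lambertW0 (lam / q * Real.exp g))) ∧
    -- 6. interior critical points
    (∀ b : ℝ, 0 ≤ b → etaDiag c lam mu q k P b
        = γ b / θ b - q * j b - k / (mu * θ b) * claimCdf mu ((j b + P) / k)) ∧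
    (∀ a b : ℝ, 0 < a → 0 < b →
      HasDerivAt (fun a' => J a' b) 0 a → HasDerivAt (fun b' => J a b') 0 b →
      J a b = j b ∧ j b = k * a - P ∧ a = sfun c lam mu q k P b ∧
        etaDiag c lam mu q k P b = 0) ∧
    -- 7. the equation `η(b) = 0` solved for `P`
    (∀ b : ℝ, 0 ≤ b →
      (etaDiag c lam mu q k P b = 0 ↔
        0 < 1 + (q * θ b * j b - γ b) / (k / mu) ∧
        P = -(k / mu) * Real.log (1 + (q * θ b * j b - γ b) / (k / mu)) - j b)) := by
  have hk0 : 0 < k := by linarith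
  obtain ⟨Φ, r, h⟩ := exists_isRootPair hc hlam hmu hq
  intro J W C' γ θ j η h' A
  have hW : ∀ b, 0 ≤ b → 0 < W b := fun b hb => scaleW_pos h hc hlam hmu hq hb
  have hC : ∀ b, 0 ≤ b → 0 < C' b := fun b hb => jumpScaleDeriv_pos h hc hlam hmu hq hb
  have hθ : ∀ b, 0 ≤ b → 0 < θ b := fun b hb => theta_pos h hc hlam hmu hq hb
  have hJ1 : ∀ a b : ℝ, 0 ≤ a → 0 ≤ b →
      Integrable (fun ω => profit c q k P a b 0 (fun n => τ n ω) (fun n => Y n ω)) Pr ∧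
      J a b = (1 - C' b * (k * truncMean mu a + P * claimTail mu a))
        / (claimTail mu a * C' b + q * W b) := fun a b ha hb =>
    expectedProfit_zero_eq hclaims h hc hlam hmu hq ha hb
  have hJ : ∀ a b : ℝ, 0 ≤ a → 0 ≤ b → J a b = costFun mu q k P (γ b) (θ b) a := by
    intro a b ha hb
    have h1 := hC b hb
    have h2 := hW b hb
    have h3 : 0 < claimTail mu a := by rw [claimTail_eq]; exact Real.exp_pos _
    have h4 : γ b = 1 / C' b := rfl
    have h5 : θ b = W b / C' b := rfl
    rw [(hJ1 a b ha hb).2, costFun, h4, h5]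
    field_simp
    ring
  have hη : ∀ a b : ℝ, η b a
      = γ b / θ b - k / (mu * θ b) * claimCdf mu a - q * (k * a - P) := fun a b => rfl
  have hJη : ∀ a b : ℝ, 0 ≤ a → 0 ≤ b →
      J a b - (k * a - P) = θ b * η b a / (q * θ b + claimTail mu a) := by
    intro a b ha hb
    rw [hJ a b ha hb, hη, costFun_sub hmu hq (hθ b hb)]
  have hJη0 : ∀ a b : ℝ, 0 ≤ a → 0 ≤ b → (J a b - (k * a - P) = 0 ↔ η b a = 0) := by
    intro a b ha hb
    rw [hJη a b ha hb, div_eq_zero_iff, or_iff_left (costFun_den_pos hq (hθ b hb)).ne',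
      mul_eq_zero, or_iff_right (hθ b hb).ne']
  have part2 : ∀ a b : ℝ, 0 ≤ a → 0 ≤ b →
      DifferentiableWithinAt ℝ γ (Ici 0) b ∧ DifferentiableWithinAt ℝ θ (Ici 0) b ∧
      0 < derivWithin θ (Ici 0) b ∧
      (HasDerivWithinAt (fun b' => J a b') 0 (Ici 0) b ↔ J a b = j b) := by
    intro a b ha hb
    have hγd : DifferentiableWithinAt ℝ γ (Ici 0) b :=
      differentiableWithinAt_gam h hc hlam hmu hq hb
    obtain ⟨d, hd0, hd⟩ := exists_hasDerivWithinAt_theta h hc hlam hmu hq hb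
    have hu : UniqueDiffWithinAt ℝ (Ici (0 : ℝ)) b := uniqueDiffOn_Ici 0 b hb
    have hdθ : derivWithin θ (Ici 0) b = d := hd.derivWithin hu
    refine ⟨hγd, hd.differentiableWithinAt, by rw [hdθ]; exact hd0, ?_⟩
    set d' := derivWithin γ (Ici 0) b with hd'
    have hj : j b = d' / (q * d) := by rw [← hdθ]; rfl
    have hden := costFun_den_pos (mu := mu) (a := a) hq (hθ b hb)
    -- the quotient rule, with `γ' = q θ' j`
    have hJd : HasDerivWithinAt (fun b' => J a b')
        (q * d * (j b - J a b) / (q * θ b + claimTail mu a)) (Ici 0) b := by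
      have h1 := ((hγd.hasDerivWithinAt.sub_const (k * truncMean mu a)).sub_const
        (P * claimTail mu a)).div ((hd.const_mul q).add_const (claimTail mu a)) hden.ne'
      refine (h1.congr (fun b' hb' => hJ a b' ha hb') (hJ a b ha hb)).congr_deriv ?_
      rw [hJ a b ha hb, costFun, hj, ← hd']
      change (d' * (q * θ b + claimTail mu a)
        - (γ b - k * truncMean mu a - P * claimTail mu a) * (q * d))
          / (q * θ b + claimTail mu a) ^ 2 = _
      field_simp
    have hzero : q * d * (j b - J a b) / (q * θ b + claimTail mu a) = 0 ↔ J a b = j b := by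
      rw [div_eq_zero_iff, or_iff_left hden.ne', mul_eq_zero, or_iff_right (by positivity),
        sub_eq_zero, eq_comm]
    rw [← hzero]
    exact ⟨fun h0 => hu.eq_deriv _ hJd h0, fun h0 => h0 ▸ hJd⟩
  have part3 : ∀ a b : ℝ, 0 < a → 0 ≤ b →
      (HasDerivAt (fun a' => J a' b) 0 a ↔ J a b - (k * a - P) = 0) := by
    intro a b ha hb
    have hden := costFun_den_pos (mu := mu) (a := a) hq (hθ b hb)
    have htail : 0 < claimTail mu a := by rw [claimTail_eq]; exact Real.exp_pos _
    -- `J` is given by the explicit formula for nonnegative thresholds only, hence near `a > 0`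
    have hJd : HasDerivAt (fun a' => J a' b)
        (mu * claimTail mu a * (J a b - (k * a - P)) / (q * θ b + claimTail mu a)) a := by
      rw [hJ a b ha.le hb]
      refine (hasDerivAt_costFun hmu hq (hθ b hb)).congr_of_eventuallyEq ?_
      filter_upwards [lt_mem_nhds ha] with a' ha' using hJ a' b ha'.le hb
    have hzero : mu * claimTail mu a * (J a b - (k * a - P)) / (q * θ b + claimTail mu a) = 0 ↔
        J a b - (k * a - P) = 0 := by
      rw [div_eq_zero_iff, or_iff_left hden.ne', mul_eq_zero, or_iff_right (by positivity)]
    rw [← hzero]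
    exact ⟨fun h0 => hJd.unique h0, fun h0 => h0 ▸ hJd⟩
  have hηA : ∀ b, 0 ≤ b → ∀ a, η b a = 0 ↔ a = A b := fun b hb a =>
    eta_eq_zero_iff hmu hq hk0 (hθ b hb)
  have hApos : ∀ b, 0 ≤ b → (0 < A b ↔ 0 < 1 / (q * W b) + P) := by
    intro b hb
    -- `η(b, ·)` is decreasing and vanishes at `A b`, so the sign of `A b` is that of `η(b, 0)`
    have h0 : η b 0 = q * (1 / (q * W b) + P) := by
      have h1 := hC b hb
      have h2 := hW b hb
      have h4 : γ b = 1 / C' b := rfl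
      have h5 : θ b = W b / C' b := rfl
      rw [hη, h4, h5, claimCdf]
      simp only [mul_zero, neg_zero, Real.exp_zero, sub_self]
      field_simp
      ring
    rw [← (eta_strictAnti (P := P) hmu hq hk0 (hθ b hb)).lt_iff_gt,
      show eta c lam mu q k P b (A b) = 0 from (hηA b hb _).2 rfl,
      show eta c lam mu q k P b 0 = q * (1 / (q * W b) + P) from h0, mul_pos_iff_of_pos_left hq]
  have hdiag : ∀ b, etaDiag c lam mu q k P b
      = γ b / θ b - q * j b - k / (mu * θ b) * claimCdf mu ((j b + P) / k) := by
    intro b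
    change γ b / θ b - k / (mu * θ b) * claimCdf mu ((j b + P) / k)
      - q * (k * ((j b + P) / k) - P) = _
    rw [mul_div_cancel₀ _ hk0.ne']
    ring
  refine ⟨fun a b ha hb => ⟨(hJ1 a b ha hb).1, hC b hb, (hJ1 a b ha hb).2, hJ a b ha hb⟩, part2,
    fun a b ha hb => ⟨part3 a b ha hb, (part3 a b ha hb).trans (hJη0 a b ha.le hb)⟩, ?_, ?_,
    fun b _ => hdiag b, ?_, ?_⟩
  · intro _ b hb
    have hηAb : η b (A b) = 0 := (hηA b hb _).2 rfl
    refine ⟨hηA b hb, hApos b hb, fun hP => (hApos b hb).2 ?_, fun hA0 => ?_⟩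
    · have := hW b hb
      positivity
    · have hJA : J (A b) b = k * A b - P := sub_eq_zero.1 ((hJη0 _ b hA0 hb).2 hηAb)
      refine ⟨fun a ha => ?_, ?_⟩
      · change J a b ≤ J (A b) b
        rw [hJA, hJ a b ha hb]
        exact costFun_le hmu hq hk0 (hθ b hb) hηAb
      · have hAb : A b = 1 / mu * (-h' b + lambertW0 (Real.exp (h' b) / (q * θ b))) := rfl
        rw [hJA, hAb, one_div_mul_eq_div (q * θ b)]
        ring
  · intro c' δ g
    have hgap : Φ - r ≠ 0 := by linarith [h.neg, h.pos]
    have hW0 : W 0 = 1 / c := by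
      change scaleW c lam mu q 0 = _
      rw [scaleW_eq h hc hlam hmu hq le_rfl, expScale]
      simp only [mul_zero, Real.exp_zero]
      field_simp
      ring
    have hC0 : C' 0 = lam / c := by
      change jumpScaleDeriv c lam mu q 0 = _
      rw [jumpScaleDeriv_eq h hc hlam hmu hq le_rfl, expJumpScaleDeriv]
      simp only [mul_zero, Real.exp_zero]
      field_simp
    have hγ0 : γ 0 = c / lam := by
      change 1 / C' 0 = _
      rw [hC0, one_div_div]
    have hθ0 : θ 0 = 1 / lam := by
      change W 0 / C' 0 = _
      rw [hW0, hC0]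
      field_simp
    have hg : g = h' 0 := by
      change lam / q - mu / (k * q) * (c + q * P)
        = 1 / (q * θ 0) - mu / k * (γ 0 / (q * θ 0) + P)
      rw [hθ0, hγ0]
      field_simp
    have hδ : ∀ a : ℝ, η 0 a = δ a := by
      intro a
      change _ = c + q * P - k * (a * q + lam / mu * (1 - Real.exp (-(mu * a))))
      rw [hη, hγ0, hθ0, claimCdf]
      field_simp
      ring
    have hA0 : mu * A 0 = -g + lambertW0 (lam / q * Real.exp g) := by
      have hA : A 0 = 1 / mu * (-h' 0 + lambertW0 (Real.exp (h' 0) / (q * θ 0))) := rfl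
      have hy : lam / q * Real.exp g = Real.exp (h' 0) / (q * θ 0) := by
        rw [hg, hθ0]
        field_simp
      rw [hA, hy, hg]
      field_simp
    refine ⟨hδ, hg, fun _ a => ?_, fun hc' => ?_⟩
    · rw [← hδ, hηA 0 le_rfl, ← hA0]
      exact ⟨fun ha => ha ▸ rfl, fun ha => mul_left_cancel₀ hmu.ne' ha⟩
    · rw [← hA0]
      refine mul_pos hmu ((hApos 0 le_rfl).2 ?_)
      have h1 : 1 / (q * W 0) + P = c' / q := by
        change _ = (c + q * P) / q
        rw [hW0]
        field_simp
      rw [h1]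
      exact div_pos hc' hq
  · intro a b ha hb hda hdb
    have h1 : J a b - (k * a - P) = 0 := (part3 a b ha hb.le).1 hda
    have h2 : J a b = j b := (part2 a b ha.le hb.le).2.2.2.1 hdb.hasDerivWithinAt
    have h3 : j b = k * a - P := by linarith
    have h4 : a = sfun c lam mu q k P b := by
      change a = (j b + P) / k
      rw [h3]
      field_simp
      ring
    refine ⟨h2, h3, h4, ?_⟩
    rw [etaDiag, ← h4]
    exact (hJη0 a b ha.le hb.le).1 h1
  · intro b hb
    have ht := hθ b hb
    rw [hdiag, claimCdf]
    set X := 1 + (q * θ b * j b - γ b) / (k / mu) with hX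
    have hiff : γ b / θ b - q * j b - k / (mu * θ b)
          * (1 - Real.exp (-(mu * ((j b + P) / k)))) = 0 ↔
        Real.exp (-(mu * ((j b + P) / k))) = X := by
      have h1 : γ b / θ b - q * j b - k / (mu * θ b)
          * (1 - Real.exp (-(mu * ((j b + P) / k))))
          = k / (mu * θ b) * (Real.exp (-(mu * ((j b + P) / k))) - X) := by
        generalize Real.exp (-(mu * ((j b + P) / k))) = E
        rw [hX]
        field_simp
        ring
      rw [h1, mul_eq_zero, or_iff_right (by positivity), sub_eq_zero]
    have hlog : ∀ l : ℝ, -(mu * ((j b + P) / k)) = l ↔ P = -(k / mu) * l - j b := by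
      intro l
      constructor
      · rintro rfl
        field_simp
        ring
      · intro hP
        rw [hP]
        field_simp
        ring
    rw [hiff, ← hlog]
    constructor
    · intro hE
      exact ⟨hE ▸ Real.exp_pos _, by rw [← hE, Real.log_exp]⟩
    · rintro ⟨hX0, hl⟩
      rw [hl, Real.exp_log hX0]
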